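/- Let $n\in\mathbb N$ and $t>0$, and for $s>0$ let $d\mu_s(z)=(\pi s)^{-n}e^{-|z|^2/s}\,dz$ on $\mathbb C^n$. For $1\le p<\infty$ let $F_t^p$ be the space of entire functions on $\mathbb C^n$ in $L^p(\mathbb C^n,\mu_{2t/p})$ with the norm of that space; let $F_t^\infty$ be the space of entire functions $f$ with $\|f\|=\sup_z|f(z)|e^{-|z|^2/(2t)}<\infty$, and $f_t^\infty\subset F_t^\infty$ the subspace of those $f$ for which $f e^{-|\cdot|^2/(2t)}$ vanishes at infinity. Let $\mathbb F_t$ be any of the spaces $F_t^p$ ($1\le p\le\infty$) or $f_t^\infty$, and $\mathcal L(\mathbb F_t)$ the bounded linear operators on it. For $z\in\mathbb C^n$ let $W_z^t g(w)=e^{w\cdot\overline z/t-|z|^2/(2t)}\,g(w-z)$ be the Weyl operator, an isometry of $\mathbb F_t$, and for $A\in\mathcal L(\mathbb F_t)$ put $\alpha_z(A)=W_z^tAW_{-z}^t$. Let $$\mathcal C_1(\mathbb F_t)=\{A\in\mathcal L(\mathbb F_t):\ \|\alpha_z(A)-A\|\to0\ \text{as}\ |z|\to0\}.$$ For $f\in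 L^\infty(\mathbb C^n)$ let $T_f^t g(z)=\int_{\mathbb C^n} f(w)g(w)e^{z\cdot\overline w/t}\,d\mu_t(w)$ be the Toeplitz operator on $\mathbb F_t$ with symbol $f$. Let $\mathcal W_t$ be the class of measurable $k:\mathbb C^n\times\mathbb C^n\to\mathbb C$ such that $k(w,z)$ is holomorphic in $z$ and anti-holomorphic in $w$, and such that $|k(w,z)|\le e^{(|z|^2+|w|^2)/(2t)}H(w-z)$ for all $w,z$, with some non-negative $H\in L^1(\mathbb C^n)$. For $k\in\mathcal W_t$ put $A_kf(z)=\int_{\mathbb C^n}f(w)k(w,z)\,d\mu_t(w)$, and let $\mathcal W_t(\mathbb F_t)=\{A\in\mathcal L(\mathbb F_t):\ A=A_k \text{ for some } k\in\mathcal W_t\}$. **Theorem.** For every choice of $\mathbb F_t$: each $A_k$ with $k\in\mathcal W_t$ is a well-defined bounded linear operator on $\mathbb F_t$, and $\mathcal W_t(\mathbb F_t)\subset\mathcal C_1(\mathbb F_t)$, that is, $\|\alpha_z(A_k)-A_k\|\to0$ as $|z|\to0$. Moreover, every operator in $\mathcal W_t(\mathbb F_t)$ lies in the Banach algebra generated by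 the Toeplitz operators with bounded symbols, i.e. in the operator norm closure in $\mathcal L(\mathbb F_t)$ of the algebra generated by $\{T_f^t:\ f\in L^\infty(\mathbb C^n)\}$. -/

import Mathlib

open MeasureTheory Filter Topology
open scoped ENNReal

noncomputable section

namespace Fock

/-- `ℂⁿ` with its Euclidean norm and Lebesgue measure `volume`. Mathlib's inner product
`inner ℂ z w` is conjugate linear in the first slot, so it is `w · z̄ = ∑ j, w j * conj (z j)`. -/
abbrev Cn (n : ℕ) : Type := EuclideanSpace ℂ (Fin n)

/-- The Gaussian density `(π s)⁻ⁿ exp (-|z|² / s)` on `ℂⁿ`. -/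
def gaussDensity (n : ℕ) (s : ℝ) (z : Cn n) : ℝ :=
  ((Real.pi * s) ^ n)⁻¹ * Real.exp (-(‖z‖ ^ 2 / s))

/-- The Gaussian measure `μ_s` on `ℂⁿ`. -/
def gaussMeasure (n : ℕ) (s : ℝ) : Measure (Cn n) :=
  volume.withDensity fun z => ENNReal.ofReal (gaussDensity n s z)

/-- The labels of the Fock spaces with a fixed parameter `t`: `finite p` stands for `F_t^p` with
`1 ≤ p < ∞`, `infty` for `F_t^∞`, and `vanishing` for `f_t^∞`. -/
inductive FockIndex : Type
  | finite (p : ℝ) (hp : 1 ≤ p)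
  | infty
  | vanishing

/-- The supremum norm with weight `exp (-|z|² / (2 t))`. -/
def supENorm (n : ℕ) (t : ℝ) (f : Cn n → ℂ) : ℝ≥0∞ :=
  ⨆ z : Cn n, ‖f z‖ₑ * ENNReal.ofReal (Real.exp (-(‖z‖ ^ 2 / (2 * t))))

/-- The (extended) norm of each Fock space: the norm of `L^p(μ_{2t/p})` for `p < ∞` and the
weighted supremum norm for `F_t^∞` and `f_t^∞`. -/
def fockENorm (n : ℕ) (t : ℝ) : FockIndex → (Cn n → ℂ) → ℝ≥0∞
  | .finite p _, f => eLpNorm f (ENNReal.ofReal p) (gaussMeasure n (2 * t / p))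
  | .infty, f => supENorm n t f
  | .vanishing, f => supENorm n t f

/-- `f · exp (-|·|² / (2 t))` tends to zero at infinity. -/
def VanishesAtInfinity (n : ℕ) (t : ℝ) (f : Cn n → ℂ) : Prop :=
  Tendsto (fun z : Cn n => f z * (Real.exp (-(‖z‖ ^ 2 / (2 * t))) : ℂ)) (cocompact (Cn n)) (𝓝 0)

theorem supENorm_zero (n : ℕ) (t : ℝ) : supENorm n t 0 = 0 := by
  simp [supENorm]

theorem supENorm_add_le (n : ℕ) (t : ℝ) (f g : Cn n → ℂ) :
    supENorm n t (f + g) ≤ supENorm n t f + supENorm n t g := by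
  refine iSup_le fun z => ?_
  calc ‖(f + g) z‖ₑ * ENNReal.ofReal (Real.exp (-(‖z‖ ^ 2 / (2 * t))))
      ≤ (‖f z‖ₑ + ‖g z‖ₑ) * ENNReal.ofReal (Real.exp (-(‖z‖ ^ 2 / (2 * t)))) := by
        gcongr; exact enorm_add_le _ _
    _ = ‖f z‖ₑ * ENNReal.ofReal (Real.exp (-(‖z‖ ^ 2 / (2 * t))))
        + ‖g z‖ₑ * ENNReal.ofReal (Real.exp (-(‖z‖ ^ 2 / (2 * t)))) := add_mul _ _ _
    _ ≤ _ := add_le_add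
        (le_iSup (fun z : Cn n => ‖f z‖ₑ * ENNReal.ofReal (Real.exp (-(‖z‖ ^ 2 / (2 * t))))) z)
        (le_iSup (fun z : Cn n => ‖g z‖ₑ * ENNReal.ofReal (Real.exp (-(‖z‖ ^ 2 / (2 * t))))) z)

theorem supENorm_smul (n : ℕ) (t : ℝ) (c : ℂ) (f : Cn n → ℂ) :
    supENorm n t (c • f) = ‖c‖ₑ * supENorm n t f := by
  simp only [supENorm, Pi.smul_apply, enorm_smul, mul_assoc, ENNReal.mul_iSup]

theorem fockENorm_zero (n : ℕ) (t : ℝ) (i : FockIndex) : fockENorm n t i 0 = 0 := by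
  cases i with
  | finite p hp => simp [fockENorm]
  | infty => exact supENorm_zero n t
  | vanishing => exact supENorm_zero n t

theorem fockENorm_add_le {n : ℕ} (t : ℝ) (i : FockIndex) {f g : Cn n → ℂ}
    (hf : Continuous f) (hg : Continuous g) :
    fockENorm n t i (f + g) ≤ fockENorm n t i f + fockENorm n t i g := by
  cases i with
  | finite p hp =>
    exact eLpNorm_add_le hf.aestronglyMeasurable hg.aestronglyMeasurable
      (by rw [← ENNReal.ofReal_one]; exact ENNReal.ofReal_le_ofReal hp)
  | infty => exact supENorm_add_le n t f g
  | vanishing => exact supENorm_add_le n t f g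

theorem fockENorm_smul {n : ℕ} (t : ℝ) (i : FockIndex) (c : ℂ) (f : Cn n → ℂ) :
    fockENorm n t i (c • f) = ‖c‖ₑ * fockENorm n t i f := by
  cases i with
  | finite p hp => exact eLpNorm_const_smul c f _ _
  | infty => exact supENorm_smul n t c f
  | vanishing => exact supENorm_smul n t c f

theorem fockENorm_neg {n : ℕ} (t : ℝ) (i : FockIndex) (f : Cn n → ℂ) :
    fockENorm n t i (-f) = fockENorm n t i f := by
  have h := fockENorm_smul t i (-1) f
  simpa using h

theorem gaussDensity_pos (n : ℕ) {s : ℝ} (hs : 0 < s) (z : Cn n) : 0 < gaussDensity n s z := by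
  unfold gaussDensity
  positivity

theorem continuous_gaussDensity (n : ℕ) (s : ℝ) : Continuous (gaussDensity n s) := by
  unfold gaussDensity
  fun_prop

/-- A continuous function of norm zero vanishes. -/
theorem eq_zero_of_fockENorm_eq_zero {n : ℕ} {t : ℝ} (ht : 0 < t) (i : FockIndex) {f : Cn n → ℂ}
    (hf : Continuous f) (h : fockENorm n t i f = 0) : f = 0 := by
  have hsup : supENorm n t f = 0 → f = 0 := by
    intro h
    funext z
    have hz := (ENNReal.iSup_eq_zero.mp h) z
    rcases mul_eq_zero.mp hz with h0 | h0
    · simpa using h0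
    · exact absurd (ENNReal.ofReal_eq_zero.mp h0) (not_le.mpr (Real.exp_pos _))
  cases i with
  | finite p hp =>
    have hp0 : 0 < p := lt_of_lt_of_le one_pos hp
    have hs : 0 < 2 * t / p := by positivity
    have h1 : f =ᵐ[gaussMeasure n (2 * t / p)] 0 :=
      (eLpNorm_eq_zero_iff hf.aestronglyMeasurable
        (by simpa using hp0)).mp h
    have hac : (volume : Measure (Cn n)) ≪ gaussMeasure n (2 * t / p) :=
      withDensity_absolutelyContinuous'
        (continuous_gaussDensity n _).measurable.ennreal_ofReal.aemeasurable
        (Eventually.of_forall fun z => by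
          simpa using gaussDensity_pos n hs z)
    exact (hf.ae_eq_iff_eq volume continuous_zero).mp (hac.ae_eq h1)
  | infty => exact hsup h
  | vanishing => exact hsup h

/-- The entire functions on `ℂⁿ` that belong to the Fock space with label `i`. -/
def fockSubmodule (n : ℕ) (t : ℝ) (i : FockIndex) : Submodule ℂ (Cn n → ℂ) where
  carrier := {f | Differentiable ℂ f ∧ fockENorm n t i f < ∞ ∧
    (i = FockIndex.vanishing → VanishesAtInfinity n t f)}
  zero_mem' := by
    refine ⟨differentiable_const (0 : ℂ), by rw [fockENorm_zero]; exact ENNReal.zero_lt_top,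
      fun _ => ?_⟩
    simpa [VanishesAtInfinity] using tendsto_const_nhds
  add_mem' := by
    rintro f g ⟨hf, hf', hf''⟩ ⟨hg, hg', hg''⟩
    refine ⟨hf.add hg, lt_of_le_of_lt (fockENorm_add_le t i hf.continuous hg.continuous)
      (ENNReal.add_lt_top.mpr ⟨hf', hg'⟩), fun hi => ?_⟩
    have := (hf'' hi).add (hg'' hi)
    simpa [VanishesAtInfinity, add_mul] using this
  smul_mem' := by
    rintro c f ⟨hf, hf', hf''⟩
    refine ⟨hf.const_smul c, ?_, fun hi => ?_⟩
    · rw [fockENorm_smul]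
      exact ENNReal.mul_lt_top enorm_lt_top hf'
    · have := (hf'' hi).const_mul c
      simpa [VanishesAtInfinity, mul_assoc] using this

/-- The Fock space `F_t^p`, `F_t^∞` or `f_t^∞` over `ℂⁿ`, according to the label. -/
def FockSpace (n : ℕ) (t : ℝ) (i : FockIndex) : Type := fockSubmodule n t i

variable {n : ℕ} {t : ℝ} {i : FockIndex}

instance : AddCommGroup (FockSpace n t i) := inferInstanceAs (AddCommGroup (fockSubmodule n t i))

instance : Module ℂ (FockSpace n t i) := inferInstanceAs (Module ℂ (fockSubmodule n t i))

instance : CoeFun (FockSpace n t i) fun _ => Cn n → ℂ := ⟨fun f => f.1⟩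

theorem FockSpace.continuous (f : FockSpace n t i) : Continuous f.1 := f.2.1.continuous

instance [Fact (0 < t)] : NormedAddCommGroup (FockSpace n t i) :=
  AddGroupNorm.toNormedAddCommGroup
    { toFun := fun f => (fockENorm n t i f.1).toReal
      map_zero' := by
        change (fockENorm n t i 0).toReal = 0
        rw [fockENorm_zero, ENNReal.toReal_zero]
      add_le' := fun f g => by
        change (fockENorm n t i (f.1 + g.1)).toReal ≤ _
        rw [← ENNReal.toReal_add f.2.2.1.ne g.2.2.1.ne]
        exact ENNReal.toReal_mono (ENNReal.add_lt_top.mpr ⟨f.2.2.1, g.2.2.1⟩).ne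
          (fockENorm_add_le t i f.continuous g.continuous)
      neg' := fun f => by
        change (fockENorm n t i (-f.1)).toReal = _
        rw [fockENorm_neg]
      eq_zero_of_map_eq_zero' := fun f hf => by
        refine Subtype.ext (eq_zero_of_fockENorm_eq_zero (Fact.out : 0 < t) i f.continuous ?_)
        exact ((ENNReal.toReal_eq_zero_iff _).mp hf).resolve_right f.2.2.1.ne }

theorem FockSpace.norm_def [Fact (0 < t)] (f : FockSpace n t i) :
    ‖f‖ = (fockENorm n t i f.1).toReal := rfl

instance [Fact (0 < t)] : NormedSpace ℂ (FockSpace n t i) where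
  norm_smul_le c f := by
    change (fockENorm n t i (c • f.1)).toReal ≤ ‖c‖ * (fockENorm n t i f.1).toReal
    rw [fockENorm_smul, ENNReal.toReal_mul, toReal_enorm]

/-- The reproducing kernel `K_z^t(w) = exp (w · z̄ / t)`. -/
def reproKernel (n : ℕ) (t : ℝ) (z w : Cn n) : ℂ :=
  Complex.exp (inner ℂ z w / t)

/-- The normalized reproducing kernel `k_z^t(w) = exp (w · z̄ / t - |z|² / (2 t))`. -/
def normKernel (n : ℕ) (t : ℝ) (z w : Cn n) : ℂ :=
  Complex.exp (inner ℂ z w / t - (‖z‖ ^ 2 / (2 * t) : ℝ))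

/-- `W_z^t g(w) = k_z^t(w) g(w - z)` on functions. -/
def weylFun (n : ℕ) (t : ℝ) (z : Cn n) (g : Cn n → ℂ) (w : Cn n) : ℂ :=
  normKernel n t z w * g (w - z)

theorem norm_weylFun_mul_exp (z : Cn n) (g : Cn n → ℂ) (w : Cn n) :
    ‖weylFun n t z g w‖ * Real.exp (-(‖w‖ ^ 2 / (2 * t))) =
      ‖g (w - z)‖ * Real.exp (-(‖w - z‖ ^ 2 / (2 * t))) := by
  have h : Real.exp ((inner ℂ z w / t - (‖z‖ ^ 2 / (2 * t) : ℝ) : ℂ).re) *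
      Real.exp (-(‖w‖ ^ 2 / (2 * t))) = Real.exp (-(‖w - z‖ ^ 2 / (2 * t))) := by
    rw [← Real.exp_add, Complex.sub_re, Complex.ofReal_re, Complex.div_ofReal_re,
      norm_sub_sq (𝕜 := ℂ), ← inner_conj_symm w z]
    congr 1
    simp only [RCLike.re_to_complex, Complex.conj_re]
    rcases eq_or_ne t 0 with rfl | ht
    · simp
    · field_simp
      ring
  rw [weylFun, normKernel, norm_mul, Complex.norm_exp, mul_right_comm, h, mul_comm]

theorem supENorm_weylFun (z : Cn n) (g : Cn n → ℂ) :
    supENorm n t (weylFun n t z g) = supENorm n t g := by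
  have key : ∀ (f : Cn n → ℂ) (w : Cn n),
      ‖f w‖ₑ * ENNReal.ofReal (Real.exp (-(‖w‖ ^ 2 / (2 * t)))) =
        ENNReal.ofReal (‖f w‖ * Real.exp (-(‖w‖ ^ 2 / (2 * t)))) := fun f w => by
    rw [ENNReal.ofReal_mul (norm_nonneg _), ofReal_norm]
  simp only [supENorm, key, norm_weylFun_mul_exp]
  exact (Equiv.subRight z).iSup_comp
    (g := fun w : Cn n => ENNReal.ofReal (‖g w‖ * Real.exp (-(‖w‖ ^ 2 / (2 * t)))))

theorem differentiable_weylFun (z : Cn n) {g : Cn n → ℂ} (hg : Differentiable ℂ g) :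
    Differentiable ℂ (weylFun n t z g) := by
  have h1 : Differentiable ℂ fun w : Cn n => inner ℂ z w := (innerSL ℂ z).differentiable
  have h2 : Differentiable ℂ fun w : Cn n => g (w - z) :=
    hg.comp (differentiable_id.sub_const z)
  have h3 : Differentiable ℂ fun w : Cn n => normKernel n t z w := by
    simp only [normKernel, div_eq_mul_inv]
    exact ((h1.mul_const _).sub_const _).cexp
  exact h3.mul h2

theorem fockENorm_finite_eq {p : ℝ} (hp : 1 ≤ p) {f : Cn n → ℂ} (hf : Continuous f) :
    fockENorm n t (.finite p hp) f =
      (ENNReal.ofReal ((Real.pi * (2 * t / p)) ^ n)⁻¹ *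
        ∫⁻ z, ENNReal.ofReal (‖f z‖ * Real.exp (-(‖z‖ ^ 2 / (2 * t)))) ^ p) ^ (1 / p) := by
  have hp0 : 0 < p := lt_of_lt_of_le one_pos hp
  have hm : Measurable fun z : Cn n => ENNReal.ofReal (gaussDensity n (2 * t / p) z) :=
    (continuous_gaussDensity n _).measurable.ennreal_ofReal
  rw [fockENorm, eLpNorm_eq_lintegral_rpow_enorm_toReal (by simpa using hp0) ENNReal.ofReal_ne_top,
    ENNReal.toReal_ofReal hp0.le, gaussMeasure,
    lintegral_withDensity_eq_lintegral_mul _ hm (by fun_prop), ← lintegral_const_mul' _ _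
      ENNReal.ofReal_ne_top]
  congr 2
  funext z
  have hexp : Real.exp (-(‖z‖ ^ 2 / (2 * t / p))) = Real.exp (-(‖z‖ ^ 2 / (2 * t))) ^ p := by
    rw [← Real.exp_mul]
    congr 1
    rcases eq_or_ne t 0 with rfl | ht
    · simp
    · field_simp
  rw [Pi.mul_apply, gaussDensity, ENNReal.ofReal_mul' (Real.exp_pos _).le, hexp, mul_assoc,
    ENNReal.ofReal_mul (norm_nonneg _), ofReal_norm, ENNReal.mul_rpow_of_nonneg _ _ hp0.le,
    ENNReal.ofReal_rpow_of_pos (Real.exp_pos _), mul_comm (‖f z‖ₑ ^ p)]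

/-- Weyl operators preserve the norm of every Fock space. -/
theorem fockENorm_weylFun (i : FockIndex) (z : Cn n) {g : Cn n → ℂ} (hg : Differentiable ℂ g) :
    fockENorm n t i (weylFun n t z g) = fockENorm n t i g := by
  cases i with
  | finite p hp =>
    rw [fockENorm_finite_eq hp (differentiable_weylFun z hg).continuous,
      fockENorm_finite_eq hp hg.continuous]
    simp only [norm_weylFun_mul_exp]
    rw [lintegral_sub_right_eq_self
      (fun w : Cn n => ENNReal.ofReal (‖g w‖ * Real.exp (-(‖w‖ ^ 2 / (2 * t)))) ^ p) z]
  | infty => exact supENorm_weylFun z g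
  | vanishing => exact supENorm_weylFun z g

theorem vanishesAtInfinity_weylFun (z : Cn n) {g : Cn n → ℂ} (hg : VanishesAtInfinity n t g) :
    VanishesAtInfinity n t (weylFun n t z g) := by
  have h1 : Tendsto (fun w : Cn n => w - z) (cocompact (Cn n)) (cocompact (Cn n)) :=
    (Homeomorph.subRight z).isClosedEmbedding.tendsto_cocompact
  have h2 := (tendsto_zero_iff_norm_tendsto_zero.mp hg).comp h1
  refine tendsto_zero_iff_norm_tendsto_zero.mpr (h2.congr fun w => ?_)
  simp only [Function.comp_apply, norm_mul, Complex.norm_real, Real.norm_eq_abs, Real.abs_exp,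
    norm_weylFun_mul_exp]

/-- The Weyl operator `W_z^t` on a Fock space. -/
def weyl (n : ℕ) (t : ℝ) [Fact (0 < t)] (i : FockIndex) (z : Cn n) :
    FockSpace n t i →L[ℂ] FockSpace n t i :=
  LinearIsometry.toContinuousLinearMap
    { toFun := fun g => ⟨weylFun n t z g.1, differentiable_weylFun z g.2.1,
        by rw [fockENorm_weylFun i z g.2.1]; exact g.2.2.1,
        fun hi => vanishesAtInfinity_weylFun z (g.2.2.2 hi)⟩
      map_add' := fun f g => Subtype.ext <| funext fun w => mul_add _ (f.1 (w - z)) (g.1 (w - z))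
      map_smul' := fun c f => Subtype.ext <| funext fun w =>
        mul_left_comm (normKernel n t z w) c (f.1 (w - z))
      norm_map' := fun g => congrArg ENNReal.toReal (fockENorm_weylFun i z g.2.1) }

theorem weyl_apply [Fact (0 < t)] (z : Cn n) (g : FockSpace n t i) (w : Cn n) :
    weyl n t i z g w = normKernel n t z w * g (w - z) := rfl

/-- The shift `α_z(A) = W_z^t A W_{-z}^t` of a bounded operator. -/
def shift [Fact (0 < t)] (z : Cn n) (A : FockSpace n t i →L[ℂ] FockSpace n t i) :
    FockSpace n t i →L[ℂ] FockSpace n t i :=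
  weyl n t i z * A * weyl n t i (-z)

/-- `𝒞₁(𝔽_t)`: the bounded operators with `‖α_z(A) - A‖ → 0` as `|z| → 0`. -/
def C1 (n : ℕ) (t : ℝ) [Fact (0 < t)] (i : FockIndex) :
    Set (FockSpace n t i →L[ℂ] FockSpace n t i) :=
  {A | Tendsto (fun z : Cn n => ‖shift z A - A‖) (𝓝 0) (𝓝 0)}

/-- The integral operator `P_t h(z) = ∫ h(w) exp (z · w̄ / t) dμ_t(w)`. -/
def fockProjection (n : ℕ) (t : ℝ) (h : Cn n → ℂ) (z : Cn n) : ℂ :=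
  ∫ w, h w * reproKernel n t w z ∂gaussMeasure n t

/-- `T` is the Toeplitz operator with symbol `f`, that is, `T g = P_t (f g)` for all `g`, with
absolutely convergent integrals. -/
def IsToeplitz [Fact (0 < t)] (f : Cn n → ℂ) (T : FockSpace n t i →L[ℂ] FockSpace n t i) : Prop :=
  ∀ (g : FockSpace n t i) (z : Cn n),
    Integrable (fun w => f w * g w * reproKernel n t w z) (gaussMeasure n t) ∧
      T g z = fockProjection n t (fun w => f w * g w) z

/-- The Banach algebra generated by all Toeplitz operators with bounded symbols: the operator norm
closure of the algebra that they generate. (It contains the identity, which is the Toeplitz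
operator with symbol `1`.) -/
def toeplitzAlgebra (n : ℕ) (t : ℝ) [Fact (0 < t)] (i : FockIndex) :
    Subalgebra ℂ (FockSpace n t i →L[ℂ] FockSpace n t i) :=
  (Algebra.adjoin ℂ {T | ∃ f : Cn n → ℂ, MemLp f ∞ volume ∧ IsToeplitz f T}).topologicalClosure

/-- The class `𝒲_t` of kernels `k(w, z)`. -/
structure IsWienerKernel (n : ℕ) (t : ℝ) (k : Cn n → Cn n → ℂ) : Prop where
  measurable : Measurable (Function.uncurry k)
  holomorphic : ∀ w, Differentiable ℂ fun z => k w z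
  antiholomorphic : ∀ z, Differentiable ℂ fun w => (starRingEnd ℂ) (k w z)
  bound : ∃ H : Cn n → ℝ, (∀ v, 0 ≤ H v) ∧ Integrable H volume ∧
    ∀ w z, ‖k w z‖ ≤ Real.exp ((‖z‖ ^ 2 + ‖w‖ ^ 2) / (2 * t)) * H (w - z)

/-- `A` is the integral operator `A_k f(z) = ∫ f(w) k(w, z) dμ_t(w)`, with absolutely convergent
integrals. -/
def IsIntegralOperator [Fact (0 < t)] (k : Cn n → Cn n → ℂ)
    (A : FockSpace n t i →L[ℂ] FockSpace n t i) : Prop :=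
  ∀ (f : FockSpace n t i) (z : Cn n),
    Integrable (fun w => f w * k w z) (gaussMeasure n t) ∧
      A f z = ∫ w, f w * k w z ∂gaussMeasure n t

/-- `𝒲_t(𝔽_t)`: the bounded operators on `𝔽_t` of the form `A_k` with `k ∈ 𝒲_t`. -/
def wienerOperators (n : ℕ) (t : ℝ) [Fact (0 < t)] (i : FockIndex) :
    Set (FockSpace n t i →L[ℂ] FockSpace n t i) :=
  {A | ∃ k : Cn n → Cn n → ℂ, IsWienerKernel n t k ∧ IsIntegralOperator k A}

end Fock

end

/-!
The proof rests on the reproducing formula `f(z) = ∫ f(w) e^{z·w̄/t} dμ_t(w)`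
(`Fock.integral_mul_reproKernel`). It is the translate of the mean value property `f(0) = ∫ f dμ_t`,
which in turn follows from the one-variable mean value property on the circles `{e^{iθ} w}` and the
rotation invariance of `μ_t`. Conversely, a function of finite weighted supremum norm that reproduces
itself is entire (`Fock.differentiable_of_reproducing`). This is how images under integral operators
and limits of Cauchy sequences are seen to be entire, without further theory of several complex
variables.

*Boundedness.* After multiplication by the weight `e^{-|z|²/(2t)}`, the operator `A_k` is dominated by
convolution with `H ∈ L¹`, so that Young's inequality bounds it on every Fock space
(`Fock.fockENorm_le_of_wnorm_le`). The same inequality bounds the norm of any integral operator by the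
`L¹` norm of a majorant of its kernel (`Fock.IsIntegralOperator.norm_le`).

*Norm continuity.* The operator `α_x(A_k)` has the kernel `shiftKernel t x k`. By covariance, its
difference with `k` need only be estimated at `(0, v)`. There one moves first one variable and then
the other, expresses each increment by the reproducing formula, and obtains a majorant whose `L¹` norm
tends to zero by dominated convergence (`Fock.tendsto_lintegral_shiftMajorant`).

*Approximation.* The average `∫ α_x(A_k) dμ_t(x)` is the Toeplitz operator whose symbol is the Berezin
transform `k(u, u) e^{-|u|²/t}`, a bounded function (`Fock.isToeplitz_integral_shift`). If a bounded
functional `Λ` vanishes on the Toeplitz algebra, then `φ(x) = Λ(α_x(A_k))` is a bounded function,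
continuous by the preceding step, and all its Gaussian averages `∫ φ(x + y) dμ_t(y)` vanish, because
they are values of `Λ` at Toeplitz operators. Such a function is zero, by analytic continuation and
the injectivity of the Fourier transform (`Fock.eq_zero_of_integral_gaussMeasure_eq_zero`). Hence
`Λ(A_k) = φ(0) = 0`, and the Hahn–Banach theorem puts `A_k` into the closure.
-/

namespace Fock

variable {n : ℕ} {t : ℝ} {i : FockIndex}

/-! ### Gaussian measures and the reproducing formula -/

theorem ofReal_norm_sq (z : Cn n) : ((‖z‖ ^ 2 : ℝ) : ℂ) = inner ℂ z z := by
  rw [inner_self_eq_norm_sq_to_K]; push_cast; rfl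

theorem re_inner_eq (w z : Cn n) :
    (inner ℂ w z : ℂ).re = (‖w‖ ^ 2 + ‖z‖ ^ 2 - ‖w - z‖ ^ 2) / 2 := by
  have := norm_sub_sq (𝕜 := ℂ) w z
  simp only [RCLike.re_to_complex] at this
  linarith

theorem norm_reproKernel (w z : Cn n) :
    ‖reproKernel n t w z‖ =
      Real.exp ((‖w‖ ^ 2 + ‖z‖ ^ 2 - ‖w - z‖ ^ 2) / (2 * t)) := by
  rw [reproKernel, Complex.norm_exp, Complex.div_ofReal_re, re_inner_eq, div_div]

theorem conj_reproKernel (w z : Cn n) :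
    (starRingEnd ℂ) (reproKernel n t w z) = reproKernel n t z w := by
  rw [reproKernel, ← Complex.exp_conj, map_div₀, Complex.conj_ofReal, inner_conj_symm, reproKernel]

@[fun_prop]
theorem continuous_reproKernel {X : Type*} [TopologicalSpace X] {f g : X → Cn n}
    (hf : Continuous f) (hg : Continuous g) :
    Continuous fun x => reproKernel n t (f x) (g x) := by
  unfold reproKernel; fun_prop

theorem differentiable_reproKernel (w : Cn n) : Differentiable ℂ (reproKernel n t w) := by
  have h1 : Differentiable ℂ fun z : Cn n => inner ℂ w z := (innerSL ℂ w).differentiable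
  exact (h1.mul_const (t : ℂ)⁻¹).cexp

theorem integrable_exp_neg_mul_sq_add {c : ℝ} (hc : 0 < c) (b : ℝ) :
    Integrable fun z : Cn n => Real.exp (-c * ‖z‖ ^ 2 + b * ‖z‖) := by
  have h := (GaussianFourier.integrable_cexp_neg_mul_sq_norm_add (V := Cn n) (b := ((c / 2 : ℝ) : ℂ))
    (by simpa using hc) (0 : ℂ) (0 : Cn n)).norm.mul_const (Real.exp (b ^ 2 / (2 * c)))
  refine h.mono' (by fun_prop) (Eventually.of_forall fun z => ?_)
  rw [Real.norm_eq_abs, Real.abs_exp, Complex.norm_exp, ← Real.exp_add]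
  refine Real.exp_le_exp.mpr ?_
  have : (-((c / 2 : ℝ) : ℂ) * (‖z‖ : ℂ) ^ 2 + 0 * ((inner ℝ 0 z : ℝ) : ℂ)).re = -(c/2) * ‖z‖^2 := by
    simp [← Complex.ofReal_pow]
  rw [this]
  have h2 : b ^ 2 / (2 * c) - (b * ‖z‖ - c / 2 * ‖z‖ ^ 2) = (b - c * ‖z‖) ^ 2 / (2 * c) := by
    field_simp; ring
  have h3 : 0 ≤ (b - c * ‖z‖) ^ 2 / (2 * c) := by positivity
  linarith

theorem integrable_gaussDensity (n : ℕ) {s : ℝ} (hs : 0 < s) :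
    Integrable (gaussDensity n s) := by
  have := (integrable_exp_neg_mul_sq_add (n := n) (inv_pos.mpr hs) 0).const_mul
    ((Real.pi * s) ^ n)⁻¹
  refine this.congr (Eventually.of_forall fun z => ?_)
  simp only [gaussDensity]
  congr 2; ring

theorem integral_gaussDensity (n : ℕ) {s : ℝ} (hs : 0 < s) : ∫ z, gaussDensity n s z = 1 := by
  simp only [gaussDensity, integral_const_mul]
  have h := GaussianFourier.integral_rexp_neg_mul_sq_norm (V := Cn n) (inv_pos.mpr hs)
  have hf : Module.finrank ℝ (Cn n) = 2 * n := by
    rw [← Module.finrank_mul_finrank ℝ ℂ (Cn n)]; simp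
  have h2 : ∫ z : Cn n, Real.exp (-(‖z‖ ^ 2 / s)) = (Real.pi * s) ^ n := by
    rw [hf] at h
    push_cast at h
    rw [mul_div_cancel_left₀ _ (two_ne_zero), Real.rpow_natCast, div_inv_eq_mul] at h
    rw [← h]
    congr 1; ext z; congr 1; ring
  rw [h2, inv_mul_cancel₀ (by positivity)]

theorem isProbabilityMeasure_gaussMeasure (n : ℕ) {s : ℝ} (hs : 0 < s) :
    IsProbabilityMeasure (gaussMeasure n s) := by
  refine ⟨?_⟩
  rw [gaussMeasure, withDensity_apply _ MeasurableSet.univ, Measure.restrict_univ,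
    ← ofReal_integral_eq_lintegral_ofReal (integrable_gaussDensity n hs)
      (Eventually.of_forall fun z => (gaussDensity_pos n hs z).le), integral_gaussDensity n hs]
  simp

theorem integrable_gaussMeasure_iff {s : ℝ} (hs : 0 < s) {f : Cn n → ℂ} :
    Integrable f (gaussMeasure n s) ↔ Integrable fun z => (gaussDensity n s z : ℂ) * f z := by
  rw [gaussMeasure, integrable_withDensity_iff_integrable_smul'
    (continuous_gaussDensity n s).measurable.ennreal_ofReal (by simp)]
  simp only [ENNReal.toReal_ofReal (gaussDensity_pos n hs _).le, Complex.real_smul]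

theorem integral_gaussMeasure {s : ℝ} (hs : 0 < s) (f : Cn n → ℂ) :
    ∫ z, f z ∂gaussMeasure n s = ∫ z, (gaussDensity n s z : ℂ) * f z := by
  rw [gaussMeasure, integral_withDensity_eq_integral_toReal_smul
    (continuous_gaussDensity n s).measurable.ennreal_ofReal (by simp)]
  simp only [ENNReal.toReal_ofReal (gaussDensity_pos n hs _).le, Complex.real_smul]

/-- Multiplication by a number of modulus one preserves `μ_s`. -/
theorem measurePreserving_smul_gaussMeasure (s : ℝ) {c : ℂ} (hc : ‖c‖ = 1) :
    MeasurePreserving (fun z : Cn n => c • z) (gaussMeasure n s) (gaussMeasure n s) := by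
  have hc0 : c ≠ 0 := by rintro rfl; simp at hc
  let e : Cn n ≃ₗᵢ[ℝ] Cn n :=
    { LinearEquiv.restrictScalars ℝ (LinearEquiv.smulOfNeZero ℂ (Cn n) c hc0) with
      norm_map' := fun z => by
        change ‖c • z‖ = ‖z‖
        rw [norm_smul, hc, one_mul] }
  have he : MeasurePreserving (fun z : Cn n => c • z) volume volume := e.measurePreserving
  refine ⟨he.measurable, ?_⟩
  ext S hS
  rw [Measure.map_apply he.measurable hS, gaussMeasure, withDensity_apply _ (he.measurable hS),
    withDensity_apply _ hS, ← he.setLIntegral_comp_preimage hS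
      (continuous_gaussDensity n s).measurable.ennreal_ofReal]
  simp only [gaussDensity, norm_smul, hc, one_mul]

/-- The mean value property with respect to `μ_s`: averaging an entire function over the circles
`{e^{iθ} w}` gives its value at `0`, and `μ_s` is invariant under these rotations. -/
theorem integral_gaussMeasure_eq_apply_zero {s : ℝ} (hs : 0 < s) {f : Cn n → ℂ}
    (hf : Differentiable ℂ f) (hint : Integrable f (gaussMeasure n s)) :
    ∫ w, f w ∂gaussMeasure n s = f 0 := by
  have := isProbabilityMeasure_gaussMeasure n hs
  have hmp : ∀ θ : ℝ, MeasurePreserving (fun w : Cn n => circleMap 0 1 θ • w)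
      (gaussMeasure n s) (gaussMeasure n s) := fun θ =>
    measurePreserving_smul_gaussMeasure s (by simp)
  have hrot : ∀ θ : ℝ, ∫ w, f (circleMap 0 1 θ • w) ∂gaussMeasure n s =
      ∫ w, f w ∂gaussMeasure n s := fun θ => by
    have h := (hmp θ).map_eq
    conv_rhs => rw [← h]
    rw [integral_map (hmp θ).measurable.aemeasurable hf.continuous.aestronglyMeasurable]
  have hmean : ∀ w : Cn n, Real.circleAverage (fun c : ℂ => f (c • w)) 0 1 = f 0 := fun w => by
    have hd : Differentiable ℂ fun c : ℂ => f (c • w) :=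
      hf.comp (differentiable_id.smul_const w)
    simpa using (hd.diffContOnCl (s := Metric.ball 0 |1|)).circleAverage
  have hcont : Continuous fun p : ℝ × Cn n => f (circleMap 0 1 p.1 • p.2) :=
    hf.continuous.comp (((continuous_circleMap 0 1).comp continuous_fst).smul continuous_snd)
  have hfub : Integrable (Function.uncurry fun (θ : ℝ) (w : Cn n) => f (circleMap 0 1 θ • w))
      ((volume.restrict (Set.uIoc 0 (2 * Real.pi))).prod (gaussMeasure n s)) := by
    change Integrable (fun p : ℝ × Cn n => f (circleMap 0 1 p.1 • p.2)) _
    rw [integrable_prod_iff hcont.aestronglyMeasurable]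
    refine ⟨Eventually.of_forall fun θ => ((hmp θ).integrable_comp
      hf.continuous.aestronglyMeasurable).mpr hint, ?_⟩
    have : ∀ θ : ℝ, ∫ w, ‖f (circleMap 0 1 θ • w)‖ ∂gaussMeasure n s =
        ∫ w, ‖f w‖ ∂gaussMeasure n s := fun θ => by
      conv_rhs => rw [← (hmp θ).map_eq]
      rw [integral_map (hmp θ).measurable.aemeasurable hf.continuous.norm.aestronglyMeasurable]
    simp only [this]
    rw [Set.uIoc_of_le Real.two_pi_pos.le]
    exact integrable_const _
  have hswap := intervalIntegral_integral_swap hfub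
  simp only [hrot] at hswap
  have h2 : ∀ w : Cn n, ∫ θ in (0 : ℝ)..2 * Real.pi, f (circleMap 0 1 θ • w) =
      (2 * Real.pi : ℝ) • f 0 := fun w => by
    rw [← hmean w, Real.circleAverage_def, smul_inv_smul₀ (by positivity)]
  simp only [h2] at hswap
  rw [intervalIntegral.integral_const, sub_zero, integral_const, probReal_univ, one_smul] at hswap
  exact smul_right_injective _ (by positivity : (2 * Real.pi : ℝ) ≠ 0) hswap

/-- The reproducing formula: the mean value property applied to `w ↦ f (w + z) e^{-w·z̄/s}`. -/
theorem integral_mul_reproKernel {s : ℝ} (hs : 0 < s) {f : Cn n → ℂ}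
    (hf : Differentiable ℂ f) {z : Cn n}
    (hint : Integrable (fun w => f w * reproKernel n s w z) (gaussMeasure n s)) :
    ∫ w, f w * reproKernel n s w z ∂gaussMeasure n s = f z := by
  have key : ∀ w : Cn n, (gaussDensity n s (w - z) : ℂ) *
      (f (w - z + z) * reproKernel n (-s) z (w - z)) =
        (gaussDensity n s w : ℂ) * (f w * reproKernel n s w z) := fun w => by
    have h1 : Complex.exp (-(((‖w - z‖ ^ 2 : ℝ) : ℂ) / s)) * reproKernel n (-s) z (w - z) =
        Complex.exp (-(((‖w‖ ^ 2 : ℝ) : ℂ) / s)) * reproKernel n s w z := by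
      simp only [reproKernel, ← Complex.exp_add, ofReal_norm_sq, inner_sub_left, inner_sub_right]
      have : (s : ℂ) ≠ 0 := by exact_mod_cast hs.ne'
      congr 1; push_cast; field_simp; ring
    simp only [gaussDensity]
    push_cast at h1 ⊢
    rw [sub_add_cancel]
    linear_combination (f w * ((Real.pi * s : ℂ) ^ n)⁻¹) * h1
  have hg : Differentiable ℂ fun w => f (w + z) * reproKernel n (-s) z w :=
    (hf.comp (differentiable_id.add_const z)).mul (differentiable_reproKernel z)
  have hgi : Integrable (fun w => f (w + z) * reproKernel n (-s) z w) (gaussMeasure n s) := by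
    rw [integrable_gaussMeasure_iff hs] at hint ⊢
    refine (hint.comp_add_right z).congr (Eventually.of_forall fun w => ?_)
    have := key (w + z)
    simp only [add_sub_cancel_right] at this
    exact this.symm
  have h := integral_gaussMeasure_eq_apply_zero hs hg hgi
  rw [integral_gaussMeasure hs] at h ⊢
  rw [← integral_sub_right_eq_self _ z] at h
  simp only [key] at h
  rw [h]
  simp [reproKernel]

/-! ### The Gaussian weight and integrability against the kernel -/

/-- The weight `exp (-|z|² / (2 t))`, whose square is the density of `μ_t` up to a constant. -/
noncomputable def weight (t : ℝ) (z : Cn n) : ℝ := Real.exp (-(‖z‖ ^ 2 / (2 * t)))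

/-- The weighted modulus `|f(z)| exp (-|z|² / (2 t))`, as an extended nonnegative number. -/
noncomputable def wnorm (t : ℝ) (f : Cn n → ℂ) (z : Cn n) : ℝ≥0∞ :=
  ENNReal.ofReal (‖f z‖ * weight t z)

theorem weight_pos (z : Cn n) : 0 < weight t z := Real.exp_pos _

theorem continuous_weight : Continuous (weight t : Cn n → ℝ) := by
  unfold weight; fun_prop

theorem weight_le_one (ht : 0 < t) (z : Cn n) : weight t z ≤ 1 :=
  Real.exp_le_one_iff.mpr (by have : 0 ≤ ‖z‖ ^ 2 / (2 * t) := by positivity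
                              linarith)

theorem measurable_wnorm {f : Cn n → ℂ} (hf : Continuous f) : Measurable (wnorm t f) :=
  (hf.norm.mul continuous_weight).measurable.ennreal_ofReal

theorem enorm_mul_weight (f : Cn n → ℂ) (z : Cn n) :
    ‖f z‖ₑ * ENNReal.ofReal (weight t z) = wnorm t f z := by
  rw [wnorm, ENNReal.ofReal_mul (norm_nonneg _), ofReal_norm]

theorem integrable_weight (ht : 0 < t) : Integrable (weight t : Cn n → ℝ) := by
  refine (integrable_exp_neg_mul_sq_add (n := n) (c := (2 * t)⁻¹) (by positivity) 0).congr
    (Eventually.of_forall fun z => ?_)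
  simp only [weight]
  congr 1; ring

theorem gaussDensity_eq (ht : 0 < t) (z : Cn n) :
    gaussDensity n t z = ((Real.pi * t) ^ n)⁻¹ * (weight t z * weight t z) := by
  rw [gaussDensity, weight, ← Real.exp_add]
  congr 2; field_simp; ring

theorem norm_reproKernel_mul_weight (w z : Cn n) :
    ‖reproKernel n t w z‖ * weight t w = (weight t z)⁻¹ * weight t (w - z) := by
  rw [norm_reproKernel, weight, weight, weight, ← Real.exp_neg, ← Real.exp_add, ← Real.exp_add]
  congr 1; ring

theorem gaussDensity_mul_norm (ht : 0 < t) (f : Cn n → ℂ) (w z : Cn n) :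
    gaussDensity n t w * ‖f w * reproKernel n t w z‖ =
      ((Real.pi * t) ^ n)⁻¹ * (weight t z)⁻¹ * (‖f w‖ * weight t w * weight t (w - z)) := by
  rw [gaussDensity_eq ht, norm_mul]
  linear_combination (((Real.pi * t) ^ n)⁻¹ * ‖f w‖ * weight t w) *
    norm_reproKernel_mul_weight (t := t) w z

/-- A function of finite weighted supremum norm is integrable against the reproducing kernel. -/
theorem integrable_mul_reproKernel_of_bounded (ht : 0 < t) {f : Cn n → ℂ}
    (hf : AEStronglyMeasurable f volume) {C : ℝ} (hC : ∀ w, ‖f w‖ * weight t w ≤ C) (z : Cn n) :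
    Integrable (fun w => f w * reproKernel n t w z) (gaussMeasure n t) := by
  rw [integrable_gaussMeasure_iff ht]
  have hK : Continuous fun w : Cn n => reproKernel n t w z := by fun_prop
  refine (((integrable_weight ht).comp_sub_right z).const_mul
    (((Real.pi * t) ^ n)⁻¹ * (weight t z)⁻¹ * C)).mono'
    ((Complex.continuous_ofReal.comp (continuous_gaussDensity n t)).aestronglyMeasurable.mul
      (hf.mul hK.aestronglyMeasurable)) (Eventually.of_forall fun w => ?_)
  rw [norm_mul, Complex.norm_real, Real.norm_of_nonneg (gaussDensity_pos n ht w).le,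
    gaussDensity_mul_norm ht, mul_assoc _ C]
  have := weight_pos (t := t) z
  have := weight_pos (t := t) (w - z)
  gcongr
  exact hC w

/-- A function whose weighted modulus is integrable is integrable against the reproducing
kernel. -/
theorem integrable_mul_reproKernel_of_integrable (ht : 0 < t) {f : Cn n → ℂ}
    (hf : AEStronglyMeasurable f volume) {G : Cn n → ℝ} (hG : Integrable G)
    (hfG : ∀ w, ‖f w‖ * weight t w ≤ G w) (z : Cn n) :
    Integrable (fun w => f w * reproKernel n t w z) (gaussMeasure n t) := by
  rw [integrable_gaussMeasure_iff ht]
  have hK : Continuous fun w : Cn n => reproKernel n t w z := by fun_prop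
  refine (hG.const_mul (((Real.pi * t) ^ n)⁻¹ * (weight t z)⁻¹)).mono'
    ((Complex.continuous_ofReal.comp (continuous_gaussDensity n t)).aestronglyMeasurable.mul
      (hf.mul hK.aestronglyMeasurable)) (Eventually.of_forall fun w => ?_)
  rw [norm_mul, Complex.norm_real, Real.norm_of_nonneg (gaussDensity_pos n ht w).le,
    gaussDensity_mul_norm ht]
  have := weight_pos (t := t) z
  have := weight_pos (t := t) w
  gcongr
  exact (mul_le_of_le_one_right (by positivity) (weight_le_one ht _)).trans (hfG w)

/-! ### Entire functions as exponential integrals -/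

/-- Exponential integrals `z ↦ ∫ h(w) exp (ℓ_w z) dw` are entire if `h` decays fast enough. -/
theorem differentiable_integral_mul_cexp {E : Type*} [NormedAddCommGroup E] [NormedSpace ℂ E]
    {h : Cn n → ℂ} (hm : AEStronglyMeasurable h volume)
    (hint : ∀ R : ℝ, Integrable fun w => ‖h w‖ * Real.exp (R * ‖w‖))
    {l : Cn n → E →L[ℂ] ℂ} (hl : Continuous l) {C : ℝ} (hC : ∀ w, ‖l w‖ ≤ C * ‖w‖) :
    Differentiable ℂ fun z => ∫ w, h w * Complex.exp (l w z) := by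
  intro z₀
  have hexp : ∀ z : E, Continuous fun w => Complex.exp (l w z) := fun z => by fun_prop
  have hre : ∀ (w : Cn n) (z : E), ‖Complex.exp (l w z)‖ ≤ Real.exp (C * ‖z‖ * ‖w‖) := by
    intro w z
    rw [Complex.norm_exp]
    refine Real.exp_le_exp.mpr ((Complex.re_le_norm _).trans (((l w).le_opNorm z).trans ?_))
    calc ‖l w‖ * ‖z‖ ≤ C * ‖w‖ * ‖z‖ := by gcongr; exact hC w
      _ = _ := by ring
  have hfin : ∀ z : E, Integrable fun w => h w * Complex.exp (l w z) := fun z => by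
    refine (hint (C * ‖z‖)).mono' (hm.mul (hexp z).aestronglyMeasurable)
      (Eventually.of_forall fun w => ?_)
    rw [norm_mul]
    gcongr
    exact hre w z
  have hd := hasFDerivAt_integral_of_dominated_of_fderiv_le (𝕜 := ℂ) (μ := (volume : Measure (Cn n)))
    (F := fun z w => h w * Complex.exp (l w z))
    (F' := fun z w => h w • (Complex.exp (l w z) • l w)) (x₀ := z₀)
    (bound := fun w => |C| * (‖h w‖ * Real.exp ((|C| * (‖z₀‖ + 1) + 1) * ‖w‖)))
    (Metric.ball_mem_nhds z₀ one_pos)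
    (Eventually.of_forall fun z => (hfin z).1) (hfin z₀)
    (hm.smul ((hexp z₀).smul hl).aestronglyMeasurable)
    (Eventually.of_forall fun w z hz => ?_) ((hint _).const_mul _)
    (Eventually.of_forall fun w z _ => ?_)
  · exact hd.differentiableAt
  · have hz' : ‖z‖ ≤ ‖z₀‖ + 1 := by
      have h1 := norm_le_norm_add_norm_sub' z z₀
      rw [Metric.mem_ball, dist_eq_norm] at hz
      linarith
    rw [norm_smul, norm_smul]
    have h1 : ‖l w‖ ≤ |C| * ‖w‖ := (hC w).trans (by gcongr; exact le_abs_self C)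
    have h2 : ‖w‖ ≤ Real.exp ‖w‖ := by linarith [Real.add_one_le_exp ‖w‖]
    have h3 : ‖Complex.exp (l w z)‖ ≤ Real.exp (|C| * (‖z₀‖ + 1) * ‖w‖) :=
      (hre w z).trans (Real.exp_le_exp.mpr (by gcongr; exact le_abs_self C))
    calc ‖h w‖ * (‖Complex.exp (l w z)‖ * ‖l w‖)
        ≤ ‖h w‖ * (Real.exp (|C| * (‖z₀‖ + 1) * ‖w‖) * (|C| * Real.exp ‖w‖)) := by
          gcongr
          exact h1.trans (by gcongr)
      _ = _ := by rw [add_mul, one_mul, Real.exp_add]; ring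
  · exact ((l w).hasFDerivAt.cexp).const_mul (h w)

theorem norm_smul_innerSL_le (ht : 0 < t) (w : Cn n) :
    ‖((t : ℂ)⁻¹) • innerSL ℂ w‖ ≤ t⁻¹ * ‖w‖ := by
  rw [norm_smul, innerSL_apply_norm, norm_inv, Complex.norm_real, Real.norm_of_nonneg ht.le]

/-- A function of finite weighted supremum norm that reproduces itself is entire. -/
theorem differentiable_of_reproducing (ht : 0 < t) {f : Cn n → ℂ}
    (hf : AEStronglyMeasurable f volume) {C : ℝ} (hC : ∀ w, ‖f w‖ * weight t w ≤ C)
    (hrep : ∀ z, ∫ w, f w * reproKernel n t w z ∂gaussMeasure n t = f z) :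
    Differentiable ℂ f := by
  have hgm : AEStronglyMeasurable (fun w => (gaussDensity n t w : ℂ) * f w) volume :=
    (Complex.continuous_ofReal.comp (continuous_gaussDensity n t)).aestronglyMeasurable.mul hf
  have hl : Continuous fun w : Cn n => (t : ℂ)⁻¹ • innerSL ℂ w :=
    Continuous.const_smul (innerSL ℂ (E := Cn n)).continuous (t : ℂ)⁻¹
  have h := differentiable_integral_mul_cexp (n := n)
    (h := fun w => (gaussDensity n t w : ℂ) * f w) hgm
    (fun R => ?_) (l := fun w => (t : ℂ)⁻¹ • innerSL ℂ w)
    hl (norm_smul_innerSL_le ht)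
  · refine (funext fun z => ?_ : f = _) ▸ h
    rw [← hrep z, integral_gaussMeasure ht]
    refine integral_congr_ae (Eventually.of_forall fun w => ?_)
    simp only [reproKernel, FunLike.coe_smul, Pi.smul_apply, innerSL_apply_apply,
      smul_eq_mul, mul_assoc]
    rw [div_eq_inv_mul]
  · have hi := (integrable_exp_neg_mul_sq_add (n := n) (c := (2 * t)⁻¹) (by positivity) R).const_mul
      (((Real.pi * t) ^ n)⁻¹ * C)
    refine hi.mono' (hgm.norm.mul (by fun_prop : Continuous fun w : Cn n =>
      Real.exp (R * ‖w‖)).aestronglyMeasurable) (Eventually.of_forall fun w => ?_)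
    rw [norm_mul, norm_norm, norm_mul, Complex.norm_real,
      Real.norm_of_nonneg (gaussDensity_pos n ht w).le, gaussDensity_eq ht, Real.norm_eq_abs,
      Real.abs_exp, Real.exp_add]
    have e : Real.exp (-(2 * t)⁻¹ * ‖w‖ ^ 2) = weight t w := by
      simp only [weight]; congr 1; ring
    rw [e]
    have := weight_pos (t := t) w
    calc _ = ((Real.pi * t) ^ n)⁻¹ * (‖f w‖ * weight t w) * (weight t w * Real.exp (R * ‖w‖)) := by
          ring
      _ ≤ _ := by gcongr; exact hC w

/-! ### Young's inequality -/

/-- Young's inequality for Fock norms: if the weighted modulus of `h` is dominated by the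
convolution of that of `f` with `N`, then `‖h‖ ≤ ‖N‖₁ ‖f‖`. -/
theorem fockENorm_le_of_wnorm_le (i : FockIndex) {f h : Cn n → ℂ}
    (hf : Continuous f) (hh : Continuous h) {N : Cn n → ℝ≥0∞} (hN : Measurable N)
    (hle : ∀ z, wnorm t h z ≤ ∫⁻ w, wnorm t f w * N (w - z)) :
    fockENorm n t i h ≤ (∫⁻ v, N v) * fockENorm n t i f := by
  have hNz : ∀ z, ∫⁻ w, N (w - z) = ∫⁻ v, N v := fun z => lintegral_sub_right_eq_self N z
  have hsup : supENorm n t h ≤ (∫⁻ v, N v) * supENorm n t f := by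
    refine iSup_le fun z => ?_
    change ‖h z‖ₑ * ENNReal.ofReal (weight t z) ≤ _
    rw [enorm_mul_weight]
    refine (hle z).trans ?_
    calc ∫⁻ w, wnorm t f w * N (w - z) ≤ ∫⁻ w, supENorm n t f * N (w - z) := by
          refine lintegral_mono fun w => ?_
          rw [← enorm_mul_weight]
          gcongr
          exact le_iSup (fun w : Cn n => ‖f w‖ₑ * ENNReal.ofReal (Real.exp (-(‖w‖ ^ 2 / (2 * t))))) w
      _ = _ := by
          rw [lintegral_const_mul _ (by fun_prop), hNz, mul_comm]
  cases i with
  | infty => exact hsup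
  | vanishing => exact hsup
  | finite p hp =>
    have hp0 : 0 < p := lt_of_lt_of_le one_pos hp
    set S := ∫⁻ v, N v with hS
    have hfm := measurable_wnorm (t := t) hf
    -- Jensen's inequality for the measure with density `N (· - z)` and total mass `S`
    have hjensen : ∀ z, (∫⁻ w, wnorm t f w * N (w - z)) ^ p ≤
        (∫⁻ w, wnorm t f w ^ p * N (w - z)) * S ^ (p - 1) := fun z => by
      have hNm : Measurable fun w => N (w - z) := hN.comp (measurable_id.sub_const z)
      have hd : ∀ g : Cn n → ℝ≥0∞, Measurable g →
          ∫⁻ w, g w * N (w - z) = ∫⁻ w, g w ∂(volume.withDensity fun w => N (w - z)) := by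
        intro g hg
        rw [lintegral_withDensity_eq_lintegral_mul _ hNm hg]
        simp only [Pi.mul_apply, mul_comm]
      rw [hd _ hfm, hd _ (hfm.pow_const p)]
      have hj := eLpNorm'_le_eLpNorm'_mul_rpow_measure_univ (p := 1) (q := p)
        (μ := volume.withDensity fun w => N (w - z)) one_pos hp hfm.aestronglyMeasurable
      rw [withDensity_apply _ MeasurableSet.univ, Measure.restrict_univ, hNz] at hj
      simp only [eLpNorm', enorm_eq_self, ENNReal.rpow_one, div_one] at hj
      refine (ENNReal.rpow_le_rpow hj hp0.le).trans_eq ?_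
      rw [ENNReal.mul_rpow_of_nonneg _ _ hp0.le, ← ENNReal.rpow_mul, ← ENNReal.rpow_mul,
        one_div_mul_cancel hp0.ne', ENNReal.rpow_one]
      congr 2
      field_simp
    have hmain : ∫⁻ z, wnorm t h z ^ p ≤ S ^ p * ∫⁻ w, wnorm t f w ^ p := by
      have hmeas2 : Measurable fun q : Cn n × Cn n => wnorm t f q.2 ^ p * N (q.2 - q.1) :=
        ((hfm.pow_const p).comp measurable_snd).mul (hN.comp (measurable_snd.sub measurable_fst))
      calc ∫⁻ z, wnorm t h z ^ p
          ≤ ∫⁻ z, (∫⁻ w, wnorm t f w ^ p * N (w - z)) * S ^ (p - 1) :=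
            lintegral_mono fun z => (ENNReal.rpow_le_rpow (hle z) hp0.le).trans (hjensen z)
        _ = (∫⁻ z, ∫⁻ w, wnorm t f w ^ p * N (w - z)) * S ^ (p - 1) :=
            lintegral_mul_const _ hmeas2.lintegral_prod_right'
        _ = (∫⁻ w, ∫⁻ z, wnorm t f w ^ p * N (w - z)) * S ^ (p - 1) := by
            rw [lintegral_lintegral_swap hmeas2.aemeasurable]
        _ = (∫⁻ w, wnorm t f w ^ p) * S * S ^ (p - 1) := by
            congr 1
            rw [← lintegral_mul_const _ (hfm.pow_const p)]
            refine lintegral_congr fun w => ?_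
            rw [lintegral_const_mul _ (by fun_prop),
              lintegral_sub_left_eq_self N w]
        _ = _ := by
            rw [mul_assoc, mul_comm]
            congr 1
            conv_lhs => rw [← ENNReal.rpow_one S]
            rw [← ENNReal.rpow_mul, one_mul, ← ENNReal.rpow_add_of_nonneg _ _ zero_le_one (by linarith)]
            congr 1; ring
    rw [fockENorm_finite_eq hp hh, fockENorm_finite_eq hp hf]
    have hS1 : S = (S ^ p) ^ (1 / p) := by
      rw [← ENNReal.rpow_mul, mul_one_div_cancel hp0.ne', ENNReal.rpow_one]
    rw [hS1, ← ENNReal.mul_rpow_of_nonneg _ _ (by positivity), mul_left_comm]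
    gcongr
    exact hmain

/-! ### Point evaluations and completeness -/

/-- At the origin the mean value property expresses `f(0)` as the average of `f` for the probability
measure `μ_{2t/p}` whose `L^p` norm is the norm of `F_t^p`. -/
theorem enorm_apply_zero_le (ht : 0 < t) (i : FockIndex) {f : Cn n → ℂ} (hf : Differentiable ℂ f)
    (hfin : fockENorm n t i f < ∞) : ‖f 0‖ₑ ≤ fockENorm n t i f := by
  have hsup : ‖f 0‖ₑ ≤ supENorm n t f := by
    have h := le_iSup (fun w : Cn n => ‖f w‖ₑ * ENNReal.ofReal (Real.exp (-(‖w‖ ^ 2 / (2 * t))))) 0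
    simpa [supENorm] using h
  cases i with
  | infty => exact hsup
  | vanishing => exact hsup
  | finite p hp =>
    have hp0 : 0 < p := lt_of_lt_of_le one_pos hp
    have hs : 0 < 2 * t / p := by positivity
    have := isProbabilityMeasure_gaussMeasure n hs
    have hm : AEStronglyMeasurable f (gaussMeasure n (2 * t / p)) :=
      hf.continuous.aestronglyMeasurable
    have h1 : eLpNorm f 1 (gaussMeasure n (2 * t / p)) ≤ fockENorm n t (.finite p hp) f :=
      eLpNorm_le_eLpNorm_of_exponent_le
        (by rw [← ENNReal.ofReal_one]; exact ENNReal.ofReal_le_ofReal hp) hm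
    have hint : Integrable f (gaussMeasure n (2 * t / p)) :=
      memLp_one_iff_integrable.mp ⟨hm, h1.trans_lt hfin⟩
    rw [← integral_gaussMeasure_eq_apply_zero hs hf hint]
    refine (enorm_integral_le_lintegral_enorm _).trans ?_
    rwa [← eLpNorm_one_eq_lintegral_enorm]

/-- Point evaluations: the weighted supremum norm is dominated by every Fock norm. -/
theorem wnorm_le_fockENorm (ht : 0 < t) (i : FockIndex) {f : Cn n → ℂ} (hf : Differentiable ℂ f)
    (hfin : fockENorm n t i f < ∞) (z : Cn n) : wnorm t f z ≤ fockENorm n t i f := by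
  have h := enorm_apply_zero_le ht i (differentiable_weylFun (t := t) (-z) hf)
    (by rwa [fockENorm_weylFun i (-z) hf])
  rw [fockENorm_weylFun i (-z) hf] at h
  refine le_trans (le_of_eq ?_) h
  have h2 := norm_weylFun_mul_exp (t := t) (-z) f 0
  simp only [norm_zero, zero_sub, neg_neg] at h2
  rw [wnorm, weight, ← h2, ← ofReal_norm]
  simp

/-- Fatou's lemma for the Fock norms. -/
theorem fockENorm_lowerSemicontinuous (i : FockIndex) {f : ℕ → Cn n → ℂ} {g : Cn n → ℂ}
    (hf : ∀ k, Continuous (f k)) (hlim : ∀ z, Tendsto (fun k => f k z) atTop (𝓝 (g z)))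
    {C : ℝ≥0∞} (hC : ∀ᶠ k in atTop, fockENorm n t i (f k) ≤ C) : fockENorm n t i g ≤ C := by
  have hsup : (∀ᶠ k in atTop, supENorm n t (f k) ≤ C) → supENorm n t g ≤ C := fun h => by
    refine iSup_le fun z => ?_
    have h2 : Tendsto (fun k => ‖f k z‖ₑ * ENNReal.ofReal (Real.exp (-(‖z‖ ^ 2 / (2 * t))))) atTop
        (𝓝 (‖g z‖ₑ * ENNReal.ofReal (Real.exp (-(‖z‖ ^ 2 / (2 * t)))))) :=
      ENNReal.Tendsto.mul_const (hlim z).enorm (Or.inr ENNReal.ofReal_ne_top)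
    refine le_of_tendsto h2 (h.mono fun k hk => le_trans ?_ hk)
    exact le_iSup (fun w : Cn n => ‖f k w‖ₑ *
      ENNReal.ofReal (Real.exp (-(‖w‖ ^ 2 / (2 * t))))) z
  cases i with
  | infty => exact hsup hC
  | vanishing => exact hsup hC
  | finite p hp =>
    refine (Lp.eLpNorm_lim_le_liminf_eLpNorm (fun k => (hf k).aestronglyMeasurable) g
      (Eventually.of_forall hlim)).trans ?_
    exact liminf_le_of_frequently_le' hC.frequently

theorem FockSpace.ext {f g : FockSpace n t i} (h : ∀ z, f z = g z) : f = g :=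
  Subtype.ext (funext h)

/-- A weighted uniform limit of functions that vanish at infinity vanishes at infinity. -/
theorem vanishesAtInfinity_of_approx {g : Cn n → ℂ}
    (h : ∀ ε : ℝ, 0 < ε → ∃ f, VanishesAtInfinity n t f ∧ ∀ z, ‖g z - f z‖ * weight t z ≤ ε) :
    VanishesAtInfinity n t g := by
  rw [VanishesAtInfinity, Metric.tendsto_nhds]
  intro ε hε
  obtain ⟨f, hf, hfg⟩ := h (ε / 2) (half_pos hε)
  filter_upwards [(Metric.tendsto_nhds.mp hf) (ε / 2) (half_pos hε)] with z hz
  rw [dist_zero_right, norm_mul, Complex.norm_real, Real.norm_of_nonneg (Real.exp_pos _).le] at hz ⊢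
  have h1 := hfg z
  have h2 : ‖g z‖ ≤ ‖g z - f z‖ + ‖f z‖ := by simpa using norm_add_le (g z - f z) (f z)
  have h3 := mul_le_mul_of_nonneg_right h2 (weight_pos (t := t) z).le
  rw [add_mul] at h3
  simp only [weight] at h1 h3
  linarith

section
variable [Fact (0 < t)]

theorem FockSpace.ofReal_norm (f : FockSpace n t i) : ENNReal.ofReal ‖f‖ = fockENorm n t i f.1 := by
  rw [FockSpace.norm_def, ENNReal.ofReal_toReal f.2.2.1.ne]

theorem FockSpace.norm_mul_weight_le (f : FockSpace n t i) (z : Cn n) :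
    ‖f z‖ * weight t z ≤ ‖f‖ := by
  have h := wnorm_le_fockENorm Fact.out i f.2.1 f.2.2.1 z
  rw [← FockSpace.ofReal_norm, wnorm] at h
  exact (ENNReal.ofReal_le_ofReal_iff (norm_nonneg _)).mp h

/-- Evaluation at a point, a bounded linear functional on each Fock space. -/
noncomputable def evalCLM (n : ℕ) (t : ℝ) [Fact (0 < t)] (i : FockIndex) (z : Cn n) :
    FockSpace n t i →L[ℂ] ℂ :=
  LinearMap.mkContinuous
    { toFun := fun f => f z
      map_add' := fun _ _ => rfl
      map_smul' := fun _ _ => rfl } (weight t z)⁻¹ fun f => by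
    rw [inv_mul_eq_div, le_div_iff₀ (weight_pos z)]
    exact f.norm_mul_weight_le z

/-- Elements of the Fock spaces are reproduced by the kernel. -/
theorem FockSpace.integral_mul_reproKernel (f : FockSpace n t i) (z : Cn n) :
    ∫ w, f w * reproKernel n t w z ∂gaussMeasure n t = f z :=
  Fock.integral_mul_reproKernel Fact.out f.2.1
    (integrable_mul_reproKernel_of_bounded Fact.out f.continuous.aestronglyMeasurable
      f.norm_mul_weight_le z)

/-- The Fock spaces are Banach spaces, so that operator-valued Bochner integrals make sense. -/
instance : CompleteSpace (FockSpace n t i) := by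
  refine Metric.complete_of_cauchySeq_tendsto fun u hu => ?_
  have ht : 0 < t := Fact.out
  have hex : ∀ z, ∃ c : ℂ, Tendsto (fun k => u k z) atTop (𝓝 c) := fun z =>
    cauchySeq_tendsto_of_complete (hu.map (evalCLM n t i z).uniformContinuous)
  choose g hg using hex
  obtain ⟨C, hC⟩ := hu.norm_bddAbove
  have hC' : ∀ k, ‖u k‖ ≤ C := fun k => hC ⟨k, rfl⟩
  have hbd : ∀ k w, ‖u k w‖ * weight t w ≤ C := fun k w =>
    ((u k).norm_mul_weight_le w).trans (hC' k)
  have hgm : AEStronglyMeasurable g (volume : Measure (Cn n)) :=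
    aestronglyMeasurable_of_tendsto_ae atTop (fun k => (u k).continuous.aestronglyMeasurable)
      (Eventually.of_forall hg)
  have hgC : ∀ w, ‖g w‖ * weight t w ≤ C := fun w =>
    le_of_tendsto ((hg w).norm.mul_const _) (Eventually.of_forall fun k => hbd k w)
  -- the limit inherits the reproducing formula, hence is entire
  have hrep : ∀ z, ∫ w, g w * reproKernel n t w z ∂gaussMeasure n t = g z := fun z => by
    have hK : Continuous fun w : Cn n => reproKernel n t w z := by fun_prop
    have hbound := integrable_mul_reproKernel_of_bounded (n := n) ht
      (f := fun w => ((C / weight t w : ℝ) : ℂ)) (C := |C|)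
      (Complex.continuous_ofReal.comp (continuous_const.div continuous_weight
        fun w => (weight_pos w).ne')).aestronglyMeasurable
      (fun w => by
        rw [Complex.norm_real, Real.norm_eq_abs, abs_div, abs_of_pos (weight_pos w),
          div_mul_cancel₀ _ (weight_pos w).ne']) z
    have hlim := tendsto_integral_of_dominated_convergence (μ := gaussMeasure n t)
      (F := fun k w => u k w * reproKernel n t w z)
      (fun w => ‖((C / weight t w : ℝ) : ℂ) * reproKernel n t w z‖)
      (fun k => ((u k).continuous.mul hK).aestronglyMeasurable) hbound.norm
      (fun k => Eventually.of_forall fun w => by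
        rw [norm_mul, norm_mul]
        gcongr
        rw [Complex.norm_real]
        exact ((le_div_iff₀ (weight_pos w)).mpr (hbd k w)).trans (le_abs_self _))
      (Eventually.of_forall fun w => (hg w).mul_const _)
    simp only [FockSpace.integral_mul_reproKernel] at hlim
    exact tendsto_nhds_unique hlim (hg z)
  have hgd : Differentiable ℂ g := differentiable_of_reproducing ht hgm hgC hrep
  have hgfin : fockENorm n t i g < ∞ :=
    (fockENorm_lowerSemicontinuous i (fun k => (u k).continuous) hg (C := ENNReal.ofReal C)
      (Eventually.of_forall fun k => by
        rw [← FockSpace.ofReal_norm]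
        exact ENNReal.ofReal_le_ofReal (hC' k))).trans_lt ENNReal.ofReal_lt_top
  have hconv : ∀ ε : ℝ, 0 < ε → ∃ N, ∀ k ≥ N, fockENorm n t i (g - (u k).1) ≤ ENNReal.ofReal ε := by
    intro ε hε
    obtain ⟨N, hN⟩ := Metric.cauchySeq_iff.mp hu ε hε
    refine ⟨N, fun k hk => fockENorm_lowerSemicontinuous i (f := fun l => (u l - u k).1)
      (fun l => (u l - u k).continuous) (fun z => (hg z).sub_const _)
      (eventually_atTop.mpr ⟨N, fun l hl => ?_⟩)⟩
    rw [← FockSpace.ofReal_norm, ← dist_eq_norm]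
    exact ENNReal.ofReal_le_ofReal (hN l hl k hk).le
  let G : FockSpace n t i := ⟨g, hgd, hgfin, fun hi => by
    refine vanishesAtInfinity_of_approx fun ε hε => ?_
    obtain ⟨N, hN⟩ := hconv ε hε
    refine ⟨(u N).1, (u N).2.2.2 hi, fun z => ?_⟩
    have h1 := hN N le_rfl
    have h2 := (wnorm_le_fockENorm ht i (hgd.sub (u N).2.1)
      (h1.trans_lt ENNReal.ofReal_lt_top) z).trans h1
    exact (ENNReal.ofReal_le_ofReal_iff hε.le).mp h2⟩
  refine ⟨G, Metric.tendsto_atTop.mpr fun ε hε => ?_⟩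
  obtain ⟨N, hN⟩ := hconv (ε / 2) (half_pos hε)
  refine ⟨N, fun k hk => ?_⟩
  rw [dist_comm, dist_eq_norm]
  have h := hN k hk
  change fockENorm n t i (G - u k).1 ≤ _ at h
  rw [← FockSpace.ofReal_norm, ENNReal.ofReal_le_ofReal_iff (half_pos hε).le] at h
  linarith

end

/-! ### Integral operators with dominated kernels -/

/-- The kernel `k` is dominated, after weighting, by the convolution kernel `N (w - z)`. -/
def KernelBound (t : ℝ) (k : Cn n → Cn n → ℂ) (N : Cn n → ℝ≥0∞) : Prop :=
  ∀ w z, ENNReal.ofReal (‖k w z‖ * weight t w * weight t z) ≤ N (w - z)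

/-- The normalizing constant `(π t)⁻ⁿ` of `μ_t`. -/
noncomputable def gaussConst (n : ℕ) (t : ℝ) : ℝ≥0∞ := ENNReal.ofReal ((Real.pi * t) ^ n)⁻¹

theorem exp_eq_weight (w z : Cn n) :
    Real.exp ((‖z‖ ^ 2 + ‖w‖ ^ 2) / (2 * t)) = (weight t w * weight t z)⁻¹ := by
  rw [weight, weight, ← Real.exp_add, ← Real.exp_neg]
  congr 1; ring

theorem IsWienerKernel.exists_real_bound {k : Cn n → Cn n → ℂ} (hk : IsWienerKernel n t k) :
    ∃ H : Cn n → ℝ, (∀ v, 0 ≤ H v) ∧ Integrable H volume ∧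
      ∀ w z, ‖k w z‖ * weight t w * weight t z ≤ H (w - z) := by
  obtain ⟨H, h0, hi, hb⟩ := hk.bound
  refine ⟨H, h0, hi, fun w z => ?_⟩
  have h := hb w z
  rw [exp_eq_weight, inv_mul_eq_div, le_div_iff₀ (mul_pos (weight_pos w) (weight_pos z))] at h
  rwa [mul_assoc]

/-- An integrable majorant may be replaced by a Borel measurable one with values in `[0, ∞]`. -/
theorem exists_measurable_ge {H : Cn n → ℝ} (hH : Integrable H) :
    ∃ N : Cn n → ℝ≥0∞, Measurable N ∧ ∫⁻ v, N v < ∞ ∧ ∀ v, ENNReal.ofReal (H v) ≤ N v := by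
  have hm := hH.1.aemeasurable
  set S := toMeasurable volume {v | H v ≠ hm.mk H v} with hS
  have hS0 : volume S = 0 := by rw [hS, measure_toMeasurable]; exact hm.ae_eq_mk
  have hSm : MeasurableSet S := measurableSet_toMeasurable _ _
  classical
  refine ⟨S.piecewise (fun _ => ∞) (fun v => ENNReal.ofReal (hm.mk H v)),
    Measurable.piecewise hSm measurable_const hm.measurable_mk.ennreal_ofReal, ?_, fun v => ?_⟩
  · have h1 : S.piecewise (fun _ => ∞) (fun v => ENNReal.ofReal (hm.mk H v)) =ᵐ[volume]
        fun v => ENNReal.ofReal (H v) := by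
      have h2 : ∀ᵐ v ∂(volume : Measure (Cn n)), v ∉ S := measure_eq_zero_iff_ae_notMem.mp hS0
      filter_upwards [h2, hm.ae_eq_mk] with v hv hv'
      rw [Set.piecewise_eq_of_notMem _ _ _ hv, hv']
    rw [lintegral_congr_ae h1]
    exact hH.lintegral_lt_top
  · by_cases hv : v ∈ S
    · rw [Set.piecewise_eq_of_mem _ _ _ hv]; exact le_top
    · rw [Set.piecewise_eq_of_notMem _ _ _ hv]
      have : H v = hm.mk H v := by
        by_contra h
        exact hv (subset_toMeasurable _ _ h)
      rw [this]

theorem IsWienerKernel.exists_kernelBound {k : Cn n → Cn n → ℂ} (hk : IsWienerKernel n t k) :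
    ∃ N : Cn n → ℝ≥0∞, Measurable N ∧ ∫⁻ v, N v < ∞ ∧ KernelBound t k N := by
  obtain ⟨H, -, hi, hb⟩ := hk.exists_real_bound
  obtain ⟨N, hm, hf, hN⟩ := exists_measurable_ge hi
  exact ⟨N, hm, hf, fun w z => (ENNReal.ofReal_le_ofReal (hb w z)).trans (hN _)⟩

/-- In weighted form, integration against `k` is dominated by convolution with `N`: the density of
`μ_t` supplies one weight for `f` and one for `k`. -/
theorem lintegral_enorm_mul_le (ht : 0 < t) {f : Cn n → ℂ} {k : Cn n → Cn n → ℂ}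
    {N : Cn n → ℝ≥0∞} (hN : KernelBound t k N) (z : Cn n) :
    (∫⁻ w, ‖f w * k w z‖ₑ ∂gaussMeasure n t) * ENNReal.ofReal (weight t z) ≤
      ∫⁻ w, wnorm t f w * (gaussConst n t * N (w - z)) := by
  rw [gaussMeasure]
  refine (mul_le_mul_left (lintegral_withDensity_le_lintegral_mul _
    (continuous_gaussDensity n t).measurable.ennreal_ofReal _) _).trans ?_
  rw [← lintegral_mul_const' _ _ ENNReal.ofReal_ne_top]
  refine lintegral_mono fun w => ?_
  have h1 := weight_pos (t := t) w
  have h2 := weight_pos (t := t) z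
  calc ENNReal.ofReal (gaussDensity n t w) * ‖f w * k w z‖ₑ * ENNReal.ofReal (weight t z)
      = wnorm t f w * (gaussConst n t *
          ENNReal.ofReal (‖k w z‖ * weight t w * weight t z)) := by
        rw [gaussDensity_eq ht, wnorm, gaussConst, ← ofReal_norm, norm_mul,
          ← ENNReal.ofReal_mul (by positivity), ← ENNReal.ofReal_mul (by positivity),
          ← ENNReal.ofReal_mul (by positivity), ← ENNReal.ofReal_mul (by positivity)]
        congr 1; ring
    _ ≤ _ := by gcongr; exact hN w z

theorem wnorm_integral_le (ht : 0 < t) {f : Cn n → ℂ} {k : Cn n → Cn n → ℂ}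
    {N : Cn n → ℝ≥0∞} (hN : KernelBound t k N) (z : Cn n) :
    wnorm t (fun z => ∫ w, f w * k w z ∂gaussMeasure n t) z ≤
      ∫⁻ w, wnorm t f w * (gaussConst n t * N (w - z)) := by
  rw [← enorm_mul_weight]
  exact (mul_le_mul_left (enorm_integral_le_lintegral_enorm _) _).trans
    (lintegral_enorm_mul_le ht hN z)

theorem lintegral_wnorm_mul_le {f : Cn n → ℂ} {C : ℝ} (hC : ∀ w, ‖f w‖ * weight t w ≤ C)
    {N : Cn n → ℝ≥0∞} (hN : Measurable N) (z : Cn n) :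
    ∫⁻ w, wnorm t f w * (gaussConst n t * N (w - z)) ≤
      ENNReal.ofReal C * (gaussConst n t * ∫⁻ v, N v) := by
  calc _ ≤ ∫⁻ w, ENNReal.ofReal C * (gaussConst n t * N (w - z)) :=
        lintegral_mono fun w => by gcongr; exact ENNReal.ofReal_le_ofReal (hC w)
    _ = _ := by
        rw [lintegral_const_mul _ (by fun_prop), lintegral_const_mul _ (by fun_prop),
          lintegral_sub_right_eq_self N z]

section
variable {k : Cn n → Cn n → ℂ} (hk : IsWienerKernel n t k)
include hk

theorem IsWienerKernel.measurable_left (z : Cn n) : Measurable fun w => k w z :=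
  hk.measurable.comp (measurable_id.prodMk measurable_const)

/-- There is a constant `D` such that the integral of `|f k(·, z)|` has weighted supremum at most
`C D` when `|f|` has weighted supremum at most `C`. -/
theorem IsWienerKernel.exists_integrable_and_bound (ht : 0 < t) :
    ∃ D : ℝ, ∀ (f : Cn n → ℂ), Measurable f → ∀ C : ℝ, (∀ w, ‖f w‖ * weight t w ≤ C) → ∀ z,
      Integrable (fun w => f w * k w z) (gaussMeasure n t) ∧
        (∫ w, ‖f w * k w z‖ ∂gaussMeasure n t) * weight t z ≤ C * D := by
  obtain ⟨N, hNm, hNf, hN⟩ := hk.exists_kernelBound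
  have hD : gaussConst n t * ∫⁻ v, N v < ∞ := ENNReal.mul_lt_top ENNReal.ofReal_lt_top hNf
  refine ⟨(gaussConst n t * ∫⁻ v, N v).toReal, fun f hf C hC z => ?_⟩
  have hle := (lintegral_enorm_mul_le ht hN z).trans (lintegral_wnorm_mul_le hC hNm z)
  have hw : ENNReal.ofReal (weight t z) ≠ 0 := by
    rw [Ne, ENNReal.ofReal_eq_zero, not_le]; exact weight_pos z
  have hlt : ∫⁻ w, ‖f w * k w z‖ₑ ∂gaussMeasure n t < ∞ :=
    ENNReal.lt_top_of_mul_ne_top_left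
      (hle.trans_lt (ENNReal.mul_lt_top ENNReal.ofReal_lt_top hD)).ne hw
  have hm : AEStronglyMeasurable (fun w => f w * k w z) (gaussMeasure n t) :=
    (hf.mul (hk.measurable_left z)).aestronglyMeasurable
  refine ⟨⟨hm, hlt⟩, ?_⟩
  have hC0 : 0 ≤ C := (mul_nonneg (norm_nonneg _) (weight_pos (0 : Cn n)).le).trans (hC 0)
  have h := ENNReal.toReal_mono (ENNReal.mul_lt_top ENNReal.ofReal_lt_top hD).ne hle
  rw [ENNReal.toReal_mul, ENNReal.toReal_mul, ENNReal.toReal_ofReal hC0,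
    ENNReal.toReal_ofReal (weight_pos z).le] at h
  rwa [integral_norm_eq_lintegral_enorm hm]

/-- The sections `k(w, ·)` are reproduced by the kernel; their weighted modulus is integrable, being
dominated by a translate and reflection of `H`. -/
theorem IsWienerKernel.integral_mul_reproKernel (ht : 0 < t) (w z : Cn n) :
    Integrable (fun u => k w u * reproKernel n t u z) (gaussMeasure n t) ∧
      ∫ u, k w u * reproKernel n t u z ∂gaussMeasure n t = k w z := by
  obtain ⟨H, -, hi, hb⟩ := hk.exists_real_bound
  have h := integrable_mul_reproKernel_of_integrable ht
    (hk.holomorphic w).continuous.aestronglyMeasurable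
    ((hi.comp_sub_left w).const_mul (weight t w)⁻¹) (fun u => by
      rw [inv_mul_eq_div, le_div_iff₀ (weight_pos w), mul_right_comm]
      exact hb w u) z
  exact ⟨h, Fock.integral_mul_reproKernel ht (hk.holomorphic w) h⟩

/-- The conjugate version of the reproducing formula, in the anti-holomorphic variable. -/
theorem IsWienerKernel.integral_mul_reproKernel_left (ht : 0 < t) (w z : Cn n) :
    Integrable (fun u => k u z * reproKernel n t w u) (gaussMeasure n t) ∧
      ∫ u, k u z * reproKernel n t w u ∂gaussMeasure n t = k w z := by
  obtain ⟨H, -, hi, hb⟩ := hk.exists_real_bound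
  have h := integrable_mul_reproKernel_of_integrable ht
    (hk.antiholomorphic z).continuous.aestronglyMeasurable
    ((hi.comp_sub_right z).const_mul (weight t z)⁻¹) (fun u => by
      rw [inv_mul_eq_div, le_div_iff₀ (weight_pos z), RCLike.norm_conj]
      exact hb u z) w
  have h2 := Fock.integral_mul_reproKernel ht (hk.antiholomorphic z) h
  have e : ∀ u, (starRingEnd ℂ) ((starRingEnd ℂ) (k u z) * reproKernel n t u w) =
      k u z * reproKernel n t w u := fun u => by
    rw [map_mul, Complex.conj_conj, conj_reproKernel]
  constructor
  · refine ((Complex.conjLIE.toContinuousLinearEquiv.toContinuousLinearMap :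
      ℂ →L[ℝ] ℂ).integrable_comp h).congr (Eventually.of_forall e)
  · have h3 := congrArg (starRingEnd ℂ) h2
    rw [← integral_conj, Complex.conj_conj] at h3
    simpa only [e] using h3

/-- The integral operator with a kernel in `𝒲_t` maps functions of finite weighted supremum norm
to entire functions: the image inherits the reproducing formula from the sections `k(w, ·)`. -/
theorem IsWienerKernel.differentiable_integral (ht : 0 < t) {f : Cn n → ℂ} (hf : Measurable f)
    {C : ℝ} (hC : ∀ w, ‖f w‖ * weight t w ≤ C) :
    Differentiable ℂ fun z => ∫ w, f w * k w z ∂gaussMeasure n t := by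
  have := isProbabilityMeasure_gaussMeasure n ht
  obtain ⟨D, hD⟩ := hk.exists_integrable_and_bound ht
  have hkm : Measurable fun p : Cn n × Cn n => f p.2 * k p.2 p.1 := by
    have h1 : Measurable fun p : Cn n × Cn n => f p.2 := hf.comp measurable_snd
    have h2 : Measurable fun p : Cn n × Cn n => k p.2 p.1 := hk.measurable.comp measurable_swap
    exact h1.mul h2
  have hFm : Measurable fun z => ∫ w, f w * k w z ∂gaussMeasure n t :=
    hkm.stronglyMeasurable.integral_prod_right'.measurable
  refine differentiable_of_reproducing ht (C := C * D)
    hFm.aestronglyMeasurable (fun z => ?_) fun u => ?_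
  · refine le_trans ?_ (hD f hf C hC z).2
    have := weight_pos (t := t) z
    gcongr
    exact norm_integral_le_integral_norm _
  · have hKm : Measurable fun z : Cn n => reproKernel n t z u :=
      (by fun_prop : Continuous fun z : Cn n => reproKernel n t z u).measurable
    have hnm : Measurable fun z => ((∫ w, ‖f w * k w z‖ ∂gaussMeasure n t : ℝ) : ℂ) :=
      Complex.measurable_ofReal.comp
        hkm.norm.stronglyMeasurable.integral_prod_right'.measurable
    have hm : Measurable
        (Function.uncurry fun z w : Cn n => f w * k w z * reproKernel n t z u) := by
      have h1 : Measurable fun p : Cn n × Cn n => reproKernel n t p.1 u := hKm.comp measurable_fst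
      exact hkm.mul h1
    have hint : Integrable (Function.uncurry fun z w => f w * k w z * reproKernel n t z u)
        ((gaussMeasure n t).prod (gaussMeasure n t)) := by
      refine (integrable_prod_iff hm.aestronglyMeasurable).mpr
        ⟨Eventually.of_forall fun z => (hD f hf C hC z).1.mul_const (reproKernel n t z u), ?_⟩
      have hb := integrable_mul_reproKernel_of_bounded (n := n) ht
        (f := fun z => ((∫ w, ‖f w * k w z‖ ∂gaussMeasure n t : ℝ) : ℂ)) (C := C * D)
        hnm.aestronglyMeasurable (fun z => by
          rw [Complex.norm_real, Real.norm_of_nonneg (integral_nonneg fun _ => norm_nonneg _)]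
          exact (hD f hf C hC z).2) u
      refine hb.norm.congr (Eventually.of_forall fun z => ?_)
      simp only [norm_mul, integral_mul_const, Complex.norm_real, Function.uncurry]
      rw [Real.norm_of_nonneg (integral_nonneg fun _ => by positivity)]
    calc ∫ z, (∫ w, f w * k w z ∂gaussMeasure n t) * reproKernel n t z u ∂gaussMeasure n t
        = ∫ z, ∫ w, f w * k w z * reproKernel n t z u ∂gaussMeasure n t ∂gaussMeasure n t :=
          integral_congr_ae (Eventually.of_forall fun z =>
            (integral_mul_const (reproKernel n t z u) _).symm)
      _ = ∫ w, ∫ z, f w * k w z * reproKernel n t z u ∂gaussMeasure n t ∂gaussMeasure n t :=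
          integral_integral_swap hint
      _ = ∫ w, f w * k w u ∂gaussMeasure n t := by
          refine integral_congr_ae (Eventually.of_forall fun w => ?_)
          simp only [mul_assoc, integral_const_mul (f w), (hk.integral_mul_reproKernel ht w u).2]

end

theorem vanishesAtInfinity_iff_wnorm {f : Cn n → ℂ} :
    VanishesAtInfinity n t f ↔ Tendsto (wnorm t f) (cocompact (Cn n)) (𝓝 0) := by
  rw [VanishesAtInfinity, tendsto_zero_iff_norm_tendsto_zero]
  have h : ∀ z, wnorm t f z = ENNReal.ofReal ‖f z * (Real.exp (-(‖z‖ ^ 2 / (2 * t))) : ℂ)‖ := by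
    intro z
    rw [norm_mul, Complex.norm_real, Real.norm_of_nonneg (Real.exp_pos _).le]
    rfl
  rw [funext h]
  constructor
  · intro h
    simpa using ENNReal.tendsto_ofReal h
  · intro h
    have h2 := (ENNReal.tendsto_toReal ENNReal.zero_ne_top).comp h
    refine h2.congr fun z => ?_
    rw [Function.comp_apply, ENNReal.toReal_ofReal (norm_nonneg _)]

/-- Convolution with an integrable function preserves vanishing at infinity. -/
theorem vanishesAtInfinity_of_wnorm_le {f h : Cn n → ℂ} (hf : Continuous f) {C : ℝ}
    (hC : ∀ w, ‖f w‖ * weight t w ≤ C) (hv : VanishesAtInfinity n t f) {N : Cn n → ℝ≥0∞}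
    (hN : Measurable N) (hNf : ∫⁻ v, N v < ∞)
    (hle : ∀ z, wnorm t h z ≤ ∫⁻ w, wnorm t f w * N (w - z)) : VanishesAtInfinity n t h := by
  rw [vanishesAtInfinity_iff_wnorm] at hv ⊢
  -- dominated convergence needs a countably generated filter
  have : (cocompact (Cn n)).IsCountablyGenerated := by
    rw [← Metric.cobounded_eq_cocompact, ← comap_norm_atTop]; infer_instance
  have hfm := measurable_wnorm (t := t) hf
  have hlim : Tendsto (fun z : Cn n => ∫⁻ v, wnorm t f (v + z) * N v) (cocompact (Cn n))
      (𝓝 (∫⁻ _ : Cn n, 0)) := by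
    refine tendsto_lintegral_filter_of_dominated_convergence (fun v => ENNReal.ofReal C * N v)
      (Eventually.of_forall fun z => (hfm.comp (measurable_add_const z)).mul hN)
      (Eventually.of_forall fun z => Eventually.of_forall fun v => ?_) ?_ ?_
    · gcongr
      exact ENNReal.ofReal_le_ofReal (hC _)
    · rw [lintegral_const_mul _ hN]
      exact (ENNReal.mul_lt_top ENNReal.ofReal_lt_top hNf).ne
    · filter_upwards [ae_lt_top hN hNf.ne] with v hNv
      have h1 : Tendsto (fun z : Cn n => v + z) (cocompact (Cn n)) (cocompact (Cn n)) :=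
        (Homeomorph.addLeft v).isClosedEmbedding.tendsto_cocompact
      simpa using ENNReal.Tendsto.mul_const (hv.comp h1) (Or.inr hNv.ne)
  rw [lintegral_zero] at hlim
  refine tendsto_of_tendsto_of_tendsto_of_le_of_le tendsto_const_nhds hlim (fun _ => zero_le)
    fun z => (hle z).trans_eq ?_
  rw [← lintegral_add_right_eq_self _ z]
  simp only [add_sub_cancel_right]

section
variable [Fact (0 < t)]

/-- Operators given by a dominated kernel have norm at most the integral of the majorant. -/
theorem IsIntegralOperator.norm_le {k : Cn n → Cn n → ℂ}
    {A : FockSpace n t i →L[ℂ] FockSpace n t i} (hA : IsIntegralOperator k A)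
    {N : Cn n → ℝ≥0∞} (hNm : Measurable N) (hN : KernelBound t k N) :
    ENNReal.ofReal ‖A‖ ≤ gaussConst n t * ∫⁻ v, N v := by
  rcases eq_or_ne (gaussConst n t * ∫⁻ v, N v) ∞ with h | h
  · rw [h]; exact le_top
  rw [ENNReal.ofReal_le_iff_le_toReal h]
  refine A.opNorm_le_bound ENNReal.toReal_nonneg fun f => ?_
  have hY := fockENorm_le_of_wnorm_le i (t := t) f.continuous (A f).continuous
    (hNm.const_mul (gaussConst n t)) fun z => by
      have h1 := wnorm_integral_le Fact.out (f := f.1) hN z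
      have h2 : (fun z => ∫ w, f w * k w z ∂gaussMeasure n t) = (A f).1 :=
        funext fun z => ((hA f z).2).symm
      rwa [h2] at h1
  rw [lintegral_const_mul _ hNm] at hY
  have h3 := ENNReal.toReal_mono (ENNReal.mul_lt_top h.lt_top f.2.2.1).ne hY
  rwa [ENNReal.toReal_mul] at h3

/-- Kernels of class `𝒲_t` define bounded operators on every Fock space. -/
theorem IsWienerKernel.exists_isIntegralOperator (i : FockIndex) {k : Cn n → Cn n → ℂ}
    (hk : IsWienerKernel n t k) :
    ∃ A : FockSpace n t i →L[ℂ] FockSpace n t i, IsIntegralOperator k A := by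
  have ht : 0 < t := Fact.out
  obtain ⟨D, hD⟩ := hk.exists_integrable_and_bound ht
  obtain ⟨N, hNm, hNf, hN⟩ := hk.exists_kernelBound
  have hcN : ∫⁻ v, gaussConst n t * N v < ∞ := by
    rw [lintegral_const_mul _ hNm]
    exact ENNReal.mul_lt_top ENNReal.ofReal_lt_top hNf
  have hd : ∀ f : FockSpace n t i,
      Differentiable ℂ fun z => ∫ w, f w * k w z ∂gaussMeasure n t := fun f =>
    hk.differentiable_integral ht f.continuous.measurable f.norm_mul_weight_le
  have hi : ∀ (f : FockSpace n t i) (z : Cn n),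
      Integrable (fun w => f w * k w z) (gaussMeasure n t) := fun f z =>
    (hD f.1 f.continuous.measurable ‖f‖ f.norm_mul_weight_le z).1
  have hY : ∀ f : FockSpace n t i,
      fockENorm n t i (fun z => ∫ w, f w * k w z ∂gaussMeasure n t) ≤
        (∫⁻ v, gaussConst n t * N v) * fockENorm n t i f.1 := fun f =>
    fockENorm_le_of_wnorm_le i f.continuous (hd f).continuous (hNm.const_mul _)
      (wnorm_integral_le ht hN)
  let L : FockSpace n t i →ₗ[ℂ] FockSpace n t i :=
    { toFun := fun f => ⟨fun z => ∫ w, f w * k w z ∂gaussMeasure n t, hd f,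
        (hY f).trans_lt (ENNReal.mul_lt_top hcN f.2.2.1),
        fun hv => vanishesAtInfinity_of_wnorm_le f.continuous f.norm_mul_weight_le (f.2.2.2 hv)
          (hNm.const_mul _) hcN (wnorm_integral_le ht hN)⟩
      map_add' := fun f g => FockSpace.ext fun z => by
        change ∫ w, (f w + g w) * k w z ∂gaussMeasure n t = _
        simp only [add_mul]
        exact integral_add (hi f z) (hi g z)
      map_smul' := fun c f => FockSpace.ext fun z => by
        change ∫ w, (c * f w) * k w z ∂gaussMeasure n t = _
        simp only [mul_assoc]
        exact integral_const_mul _ _ }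
  refine ⟨L.mkContinuous (∫⁻ v, gaussConst n t * N v).toReal fun f => ?_, fun f z => ⟨hi f z, rfl⟩⟩
  have h := ENNReal.toReal_mono (ENNReal.mul_lt_top hcN f.2.2.1).ne (hY f)
  rwa [ENNReal.toReal_mul] at h

end

/-! ### Weyl operators and shifts of kernels -/

theorem norm_normKernel_mul_weight (x z : Cn n) :
    ‖normKernel n t x z‖ * weight t z = weight t (z - x) := by
  have h := norm_weylFun_mul_exp (t := t) x (fun _ => 1) z
  simpa [weylFun, weight] using h

@[fun_prop]
theorem continuous_normKernel {X : Type*} [TopologicalSpace X] {f g : X → Cn n}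
    (hf : Continuous f) (hg : Continuous g) :
    Continuous fun x => normKernel n t (f x) (g x) := by
  unfold normKernel; fun_prop

theorem differentiable_normKernel (x : Cn n) : Differentiable ℂ (normKernel n t x) := by
  have h1 : Differentiable ℂ fun z : Cn n => inner ℂ x z := (innerSL ℂ x).differentiable
  exact ((h1.mul_const (t : ℂ)⁻¹).sub_const _).cexp

/-- The Weyl operators form a projective representation of `ℂⁿ`; this is the multiplier. -/
noncomputable def weylPhase (t : ℝ) (x y : Cn n) : ℂ :=
  Complex.exp ((inner ℂ x y - inner ℂ y x) / (2 * t))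

theorem normKernel_mul_normKernel (ht : 0 < t) (x y w : Cn n) :
    normKernel n t x w * normKernel n t y (w - x) = weylPhase t x y * normKernel n t (x + y) w := by
  have hne : (t : ℂ) ≠ 0 := by exact_mod_cast ht.ne'
  simp only [normKernel, weylPhase, ← Complex.exp_add]
  congr 1
  rw [Complex.ofReal_div, Complex.ofReal_div, Complex.ofReal_div, ofReal_norm_sq, ofReal_norm_sq,
    ofReal_norm_sq]
  simp only [inner_add_left, inner_add_right, inner_sub_right]
  push_cast
  field_simp
  ring

theorem weylPhase_mul_weylPhase_neg (x y : Cn n) :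
    weylPhase t x y * weylPhase t (-y) (-x) = 1 := by
  rw [weylPhase, weylPhase, ← Complex.exp_add]
  simp only [inner_neg_left, inner_neg_right, neg_neg]
  rw [← add_div, sub_add_sub_cancel, sub_self, zero_div, Complex.exp_zero]

theorem weylPhase_mul_conj (x y : Cn n) :
    weylPhase t x y * (starRingEnd ℂ) (weylPhase t x y) = 1 := by
  rw [weylPhase, ← Complex.exp_conj, ← Complex.exp_add]
  simp only [map_div₀, map_sub, map_mul, Complex.conj_ofReal, inner_conj_symm, map_ofNat]
  rw [← add_div, sub_add_sub_cancel, sub_self, zero_div, Complex.exp_zero]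

/-- The kernel of `α_x(A_k)`, see `IsIntegralOperator.shift`. -/
noncomputable def shiftKernel (t : ℝ) (x : Cn n) (k : Cn n → Cn n → ℂ) (w z : Cn n) : ℂ :=
  normKernel n t x z * (starRingEnd ℂ) (normKernel n t x w) * k (w - x) (z - x)

/-- In weighted modulus, passing to the shifted kernel is a simultaneous translation of both
variables. -/
theorem norm_shiftKernel_mul_weight (x : Cn n) (k : Cn n → Cn n → ℂ) (w z : Cn n) :
    ‖shiftKernel t x k w z‖ * weight t w * weight t z =
      ‖k (w - x) (z - x)‖ * weight t (w - x) * weight t (z - x) := by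
  rw [← norm_normKernel_mul_weight x w, ← norm_normKernel_mul_weight x z, shiftKernel, norm_mul,
    norm_mul, RCLike.norm_conj]
  ring

/-- The phases of the projective representation cancel, so shifts of kernels form a group action. -/
theorem shiftKernel_shiftKernel (ht : 0 < t) (x y : Cn n) (k : Cn n → Cn n → ℂ) :
    shiftKernel t x (shiftKernel t y k) = shiftKernel t (x + y) k := by
  funext w z
  simp only [shiftKernel, sub_sub]
  have h1 := normKernel_mul_normKernel ht x y z
  have h2 := congrArg (starRingEnd ℂ) (normKernel_mul_normKernel ht x y w)
  rw [map_mul, map_mul] at h2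
  have h3 := weylPhase_mul_conj (t := t) x y
  calc _ = (normKernel n t x z * normKernel n t y (z - x)) *
        ((starRingEnd ℂ) (normKernel n t x w) * (starRingEnd ℂ) (normKernel n t y (w - x))) *
          k (w - (x + y)) (z - (x + y)) := by ring
    _ = (weylPhase t x y * (starRingEnd ℂ) (weylPhase t x y)) * (normKernel n t (x + y) z *
        (starRingEnd ℂ) (normKernel n t (x + y) w) * k (w - (x + y)) (z - (x + y))) := by
        rw [h1, h2]; ring
    _ = _ := by rw [h3, one_mul]

theorem shiftKernel_sub (x : Cn n) (k l : Cn n → Cn n → ℂ) :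
    shiftKernel t x (k - l) = shiftKernel t x k - shiftKernel t x l := by
  funext w z
  simp only [shiftKernel, Pi.sub_apply, mul_sub]

theorem KernelBound.shiftKernel {k : Cn n → Cn n → ℂ} {N : Cn n → ℝ≥0∞} (h : KernelBound t k N)
    (x : Cn n) : KernelBound t (shiftKernel t x k) N := fun w z => by
  rw [norm_shiftKernel_mul_weight]
  simpa using h (w - x) (z - x)

theorem IsWienerKernel.shiftKernel {k : Cn n → Cn n → ℂ} (hk : IsWienerKernel n t k) (x : Cn n) :
    IsWienerKernel n t (shiftKernel t x k) where
  measurable := by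
    have h1 : Measurable fun p : Cn n × Cn n =>
        normKernel n t x p.2 * (starRingEnd ℂ) (normKernel n t x p.1) :=
      Continuous.measurable (by
        have h2 : Continuous fun p : Cn n × Cn n => normKernel n t x p.1 := by fun_prop
        have h3 : Continuous fun p : Cn n × Cn n => normKernel n t x p.2 := by fun_prop
        exact h3.mul (Complex.continuous_conj.comp h2))
    have h4 : Measurable fun p : Cn n × Cn n => (p.1 - x, p.2 - x) := by fun_prop
    exact h1.mul (hk.measurable.comp h4)
  holomorphic w :=
    ((differentiable_normKernel x).mul_const _).mul
      ((hk.holomorphic (w - x)).comp (differentiable_id.sub_const x))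
  antiholomorphic z := by
    have h : (fun w => (starRingEnd ℂ) (Fock.shiftKernel t x k w z)) = fun w =>
        (starRingEnd ℂ) (normKernel n t x z) * normKernel n t x w *
          (starRingEnd ℂ) (k (w - x) (z - x)) := by
      funext w
      simp only [Fock.shiftKernel, map_mul, Complex.conj_conj]
    rw [h]
    exact ((differentiable_normKernel x).const_mul _).mul
      ((hk.antiholomorphic (z - x)).comp (differentiable_id.sub_const x))
  bound := by
    obtain ⟨H, h0, hi, hb⟩ := hk.exists_real_bound
    refine ⟨H, h0, hi, fun w z => ?_⟩
    rw [exp_eq_weight, inv_mul_eq_div, le_div_iff₀ (mul_pos (weight_pos w) (weight_pos z)),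
      ← mul_assoc, norm_shiftKernel_mul_weight]
    simpa using hb (w - x) (z - x)

theorem gaussDensity_mul_normKernel (ht : 0 < t) (x w : Cn n) :
    (gaussDensity n t (w - x) : ℂ) * normKernel n t (-x) (w - x) =
      gaussDensity n t w * (starRingEnd ℂ) (normKernel n t x w) := by
  have hne : (t : ℂ) ≠ 0 := by exact_mod_cast ht.ne'
  simp only [gaussDensity, normKernel, ← Complex.exp_conj]
  rw [Complex.ofReal_mul, Complex.ofReal_mul, mul_assoc, mul_assoc, Complex.ofReal_exp,
    Complex.ofReal_exp, ← Complex.exp_add, ← Complex.exp_add]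
  congr 2
  rw [map_sub, map_div₀, Complex.conj_ofReal, Complex.conj_ofReal, inner_conj_symm]
  rw [Complex.ofReal_neg, Complex.ofReal_neg, Complex.ofReal_div, Complex.ofReal_div,
    Complex.ofReal_div, Complex.ofReal_div, ofReal_norm_sq, ofReal_norm_sq, ofReal_norm_sq,
    ofReal_norm_sq]
  simp only [inner_neg_left, inner_neg_right, inner_sub_right, inner_sub_left]
  push_cast
  field_simp
  ring

section
variable [Fact (0 < t)]

theorem shift_apply (x : Cn n) (A : FockSpace n t i →L[ℂ] FockSpace n t i) (f : FockSpace n t i)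
    (z : Cn n) : shift x A f z = normKernel n t x z * A (weyl n t i (-x) f) (z - x) := rfl

theorem weyl_weyl (x y : Cn n) (f : FockSpace n t i) :
    weyl n t i x (weyl n t i y f) = weylPhase t x y • weyl n t i (x + y) f :=
  FockSpace.ext fun z => by
    change normKernel n t x z * (normKernel n t y (z - x) * f (z - x - y)) =
      weylPhase t x y * (normKernel n t (x + y) z * f (z - (x + y)))
    rw [← mul_assoc, normKernel_mul_normKernel Fact.out, sub_sub, mul_assoc]

theorem shift_shift (x y : Cn n) (A : FockSpace n t i →L[ℂ] FockSpace n t i) :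
    shift x (shift y A) = shift (x + y) A := by
  ext1 f
  change weyl n t i x (weyl n t i y (A (weyl n t i (-y) (weyl n t i (-x) f)))) =
    weyl n t i (x + y) (A (weyl n t i (-(x + y)) f))
  rw [weyl_weyl, weyl_weyl, map_smul, map_smul, smul_smul, weylPhase_mul_weylPhase_neg, one_smul,
    neg_add_rev]

theorem shift_zero (A : FockSpace n t i →L[ℂ] FockSpace n t i) : shift 0 A = A := by
  have h : ∀ f : FockSpace n t i, weyl n t i 0 f = f := fun f => FockSpace.ext fun z => by
    rw [weyl_apply]; simp [normKernel]
  ext1 f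
  change weyl n t i 0 (A (weyl n t i (-0) f)) = A f
  rw [neg_zero, h, h]

theorem shift_sub (x : Cn n) (A B : FockSpace n t i →L[ℂ] FockSpace n t i) :
    shift x (A - B) = shift x A - shift x B := by
  simp only [shift, mul_sub, sub_mul]

theorem norm_shift_le (x : Cn n) (A : FockSpace n t i →L[ℂ] FockSpace n t i) :
    ‖shift x A‖ ≤ ‖A‖ := by
  have hw : ∀ y : Cn n, ‖weyl n t i y‖ ≤ 1 := fun y =>
    LinearIsometry.norm_toContinuousLinearMap_le _
  calc ‖shift x A‖ ≤ ‖weyl n t i x‖ * ‖A‖ * ‖weyl n t i (-x)‖ :=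
        (norm_mul_le _ _).trans (by gcongr; exact norm_mul_le _ _)
    _ ≤ 1 * ‖A‖ * 1 := by
        gcongr
        · exact hw x
        · exact hw (-x)
    _ = ‖A‖ := by ring

/-- For operators in `𝒞₁` the orbit `x ↦ α_x(A)` is norm continuous. -/
theorem continuous_shift {A : FockSpace n t i →L[ℂ] FockSpace n t i} (hA : A ∈ C1 n t i) :
    Continuous fun x : Cn n => shift x A := by
  refine continuous_iff_continuousAt.mpr fun x => ?_
  rw [ContinuousAt, tendsto_iff_norm_sub_tendsto_zero]
  have h1 : Tendsto (fun y : Cn n => y - x) (𝓝 x) (𝓝 0) := by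
    have : Continuous fun y : Cn n => y - x := by fun_prop
    simpa using this.tendsto x
  refine squeeze_zero (fun _ => norm_nonneg _) (fun y => ?_) ((show Tendsto _ _ _ from hA).comp h1)
  have h2 : shift y A - shift x A = shift x (shift (y - x) A - A) := by
    rw [shift_sub, shift_shift, add_sub_cancel]
  rw [h2]
  exact norm_shift_le x _

theorem IsIntegralOperator.sub {k l : Cn n → Cn n → ℂ}
    {A B : FockSpace n t i →L[ℂ] FockSpace n t i} (hA : IsIntegralOperator k A)
    (hB : IsIntegralOperator l B) : IsIntegralOperator (k - l) (A - B) := fun f z => by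
  simp only [Pi.sub_apply, mul_sub]
  refine ⟨(hA f z).1.sub (hB f z).1, ?_⟩
  rw [integral_sub (hA f z).1 (hB f z).1, ← (hA f z).2, ← (hB f z).2]
  rfl

theorem IsIntegralOperator.shift {k : Cn n → Cn n → ℂ}
    {A : FockSpace n t i →L[ℂ] FockSpace n t i} (hA : IsIntegralOperator k A) (x : Cn n) :
    IsIntegralOperator (shiftKernel t x k) (shift x A) := fun f z => by
  have ht : 0 < t := Fact.out
  obtain ⟨h1, h2⟩ := hA (weyl n t i (-x) f) (z - x)
  have key : ∀ w : Cn n, normKernel n t x z * ((gaussDensity n t (w - x) : ℂ) *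
      (weyl n t i (-x) f (w - x) * k (w - x) (z - x))) =
        (gaussDensity n t w : ℂ) * (f w * shiftKernel t x k w z) := fun w => by
    have h1 := gaussDensity_mul_normKernel ht x w
    rw [weyl_apply, sub_neg_eq_add, sub_add_cancel, shiftKernel]
    linear_combination (normKernel n t x z * f w * k (w - x) (z - x)) * h1
  rw [integrable_gaussMeasure_iff ht] at h1 ⊢
  rw [shift_apply, h2, integral_gaussMeasure ht, integral_gaussMeasure ht,
    ← integral_sub_right_eq_self _ x, ← integral_const_mul]
  simp only [key]
  refine ⟨((h1.comp_sub_right x).const_mul (normKernel n t x z)).congr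
    (Eventually.of_forall key), trivial⟩

end

/-! ### Norm continuity of the orbits -/

/-- A Gaussian-type envelope that dominates all translates of the weight by vectors of length at
most one. -/
noncomputable def envelope (t : ℝ) (x : Cn n) : ℝ :=
  Real.exp (-(2 * t)⁻¹ * ‖x‖ ^ 2 + t⁻¹ * ‖x‖)

theorem weight_sub_le_envelope (ht : 0 < t) {y : Cn n} (hy : ‖y‖ ≤ 1) (x : Cn n) :
    weight t (x - y) ≤ envelope t x := by
  refine Real.exp_le_exp.mpr ?_
  have h1 : ‖x‖ - ‖y‖ ≤ ‖x - y‖ := norm_sub_norm_le x y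
  have h2 : ‖x‖ ^ 2 - 2 * ‖x‖ ≤ ‖x - y‖ ^ 2 := by
    rcases le_total ‖x‖ ‖y‖ with h | h
    · nlinarith [norm_nonneg x, norm_nonneg y, sq_nonneg ‖x - y‖]
    · nlinarith [norm_nonneg x, norm_nonneg y, mul_self_le_mul_self (sub_nonneg.mpr h) h1]
  have h3 : -(‖x - y‖ ^ 2 / (2 * t)) = -(2 * t)⁻¹ * ‖x - y‖ ^ 2 := by ring
  have h4 : t⁻¹ = (2 * t)⁻¹ * 2 := by field_simp
  have h5 : 0 < (2 * t)⁻¹ := by positivity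
  rw [h3, h4]
  nlinarith

theorem weight_le_envelope (ht : 0 < t) (x : Cn n) : weight t x ≤ envelope t x := by
  simpa using weight_sub_le_envelope ht (y := 0) (by simp) x

theorem measurable_envelope : Measurable fun x : Cn n => ENNReal.ofReal (2 * envelope t x) := by
  unfold envelope; fun_prop

theorem lintegral_envelope_lt_top (ht : 0 < t) :
    ∫⁻ x : Cn n, ENNReal.ofReal (2 * envelope t x) < ∞ :=
  ((integrable_exp_neg_mul_sq_add (n := n) (c := (2 * t)⁻¹) (by positivity) t⁻¹).const_mul
    2).lintegral_lt_top

/-- The weighted size of `k_x(v) K_a(v - x) - K_a(v)`, which measures how far `K_a` is from its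
translate in the second variable. -/
noncomputable def reproDefect (t : ℝ) (x v a : Cn n) : ℝ≥0∞ :=
  ENNReal.ofReal (weight t a * weight t v *
    ‖normKernel n t x v * reproKernel n t a (v - x) - reproKernel n t a v‖)

theorem measurable_reproDefect (x : Cn n) :
    Measurable fun p : Cn n × Cn n => reproDefect t x p.1 p.2 := by
  have h1 : Continuous fun p : Cn n × Cn n => weight t p.2 * weight t p.1 :=
    (continuous_weight.comp continuous_snd).mul (continuous_weight.comp continuous_fst)
  have h2 : Continuous fun p : Cn n × Cn n =>
      normKernel n t x p.1 * reproKernel n t p.2 (p.1 - x) - reproKernel n t p.2 p.1 := by fun_prop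
  exact (h1.mul h2.norm).measurable.ennreal_ofReal

theorem reproDefect_le (ht : 0 < t) {x : Cn n} (hx : ‖x‖ ≤ 1) (v a : Cn n) :
    reproDefect t x v a ≤ ENNReal.ofReal (2 * envelope t (v - a)) := by
  refine ENNReal.ofReal_le_ofReal ?_
  have ha := weight_pos (t := t) a
  have hv := weight_pos (t := t) v
  have h1 : ‖reproKernel n t a v‖ * weight t a * weight t v = weight t (v - a) := by
    rw [norm_reproKernel_mul_weight, weight, weight, weight, norm_sub_rev, mul_right_comm,
      inv_mul_cancel₀ (Real.exp_pos _).ne', one_mul]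
  have h2 : ‖normKernel n t x v * reproKernel n t a (v - x)‖ * weight t a * weight t v =
      weight t (v - a - x) := by
    calc _ = (‖reproKernel n t a (v - x)‖ * weight t a) * (‖normKernel n t x v‖ * weight t v) := by
          rw [norm_mul]; ring
      _ = _ := by
          rw [norm_reproKernel_mul_weight, norm_normKernel_mul_weight, mul_right_comm,
            inv_mul_cancel₀ (weight_pos _).ne', one_mul, weight, weight, norm_sub_rev]
          congr 5; abel
  have h3 := weight_sub_le_envelope ht hx (v - a)
  have h4 := weight_le_envelope ht (v - a)
  calc _ ≤ weight t a * weight t v *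
        (‖normKernel n t x v * reproKernel n t a (v - x)‖ + ‖reproKernel n t a v‖) := by
        gcongr; exact norm_sub_le _ _
    _ = weight t (v - a - x) + weight t (v - a) := by rw [← h1, ← h2]; ring
    _ ≤ _ := by linarith

theorem wnorm_normKernel_sub_one_le (ht : 0 < t) {x : Cn n} (hx : ‖x‖ ≤ 1) (b : Cn n) :
    wnorm t (fun b => normKernel n t (-x) b - 1) b ≤ ENNReal.ofReal (2 * envelope t b) := by
  refine ENNReal.ofReal_le_ofReal ?_
  have hb := weight_pos (t := t) b
  have h1 := norm_normKernel_mul_weight (t := t) (-x) b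
  have h2 := weight_sub_le_envelope ht (y := -x) (by simpa using hx) b
  have h3 := weight_le_envelope ht b
  calc _ ≤ (‖normKernel n t (-x) b‖ + ‖(1 : ℂ)‖) * weight t b := by
        gcongr; exact norm_sub_le _ _
    _ = weight t (b - -x) + weight t b := by rw [add_mul, h1, norm_one, one_mul]
    _ ≤ _ := by linarith

/-- Moving the first variable from `0` to `-x`. -/
theorem IsWienerKernel.move_left_le (ht : 0 < t) {k : Cn n → Cn n → ℂ} (hk : IsWienerKernel n t k)
    {N : Cn n → ℝ≥0∞} (hN : KernelBound t k N) (x z : Cn n) :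
    ENNReal.ofReal (‖(starRingEnd ℂ) (normKernel n t x 0) * k (-x) z - k 0 z‖ * weight t z) ≤
      ∫⁻ b, wnorm t (fun b => normKernel n t (-x) b - 1) b * (gaussConst n t * N (b - z)) := by
  have h := wnorm_integral_le ht (f := fun b => normKernel n t (-x) b - 1) hN z
  refine le_trans (le_of_eq ?_) h
  obtain ⟨i1, e1⟩ := hk.integral_mul_reproKernel_left ht (-x) z
  obtain ⟨i2, e2⟩ := hk.integral_mul_reproKernel_left ht 0 z
  rw [wnorm]
  congr 3
  rw [← e1, ← e2, ← integral_const_mul, ← integral_sub (i1.const_mul _) i2]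
  refine integral_congr_ae (Eventually.of_forall fun b => ?_)
  have h3 : normKernel n t (-x) b =
      (starRingEnd ℂ) (normKernel n t x 0) * reproKernel n t (-x) b := by
    simp only [normKernel, reproKernel, ← Complex.exp_conj, ← Complex.exp_add, map_sub,
      Complex.conj_ofReal, inner_zero_right, zero_div, map_zero, norm_neg]
    congr 1; ring
  have h4 : reproKernel n t 0 b = 1 := by simp [reproKernel]
  simp only [h3, h4]
  ring

/-- Moving the second variable from `v` to `v - x`, with the first one fixed at `0`. -/
theorem IsWienerKernel.move_right_le (ht : 0 < t) {k : Cn n → Cn n → ℂ}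
    (hk : IsWienerKernel n t k) {N : Cn n → ℝ≥0∞} (hN : KernelBound t k N) (x v : Cn n) :
    ENNReal.ofReal (‖normKernel n t x v * k 0 (v - x) - k 0 v‖ * weight t v) ≤
      ∫⁻ a, gaussConst n t * N (-a) * reproDefect t x v a := by
  obtain ⟨i1, e1⟩ := hk.integral_mul_reproKernel ht 0 (v - x)
  obtain ⟨i2, e2⟩ := hk.integral_mul_reproKernel ht 0 v
  rw [← e1, ← e2, ← integral_const_mul, ← integral_sub (i1.const_mul _) i2,
    ENNReal.ofReal_mul (norm_nonneg _), ofReal_norm]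
  refine (mul_le_mul_left (enorm_integral_le_lintegral_enorm _) _).trans ?_
  rw [gaussMeasure]
  refine (mul_le_mul_left (lintegral_withDensity_le_lintegral_mul _
    (continuous_gaussDensity n t).measurable.ennreal_ofReal _) _).trans ?_
  rw [← lintegral_mul_const' _ _ ENNReal.ofReal_ne_top]
  refine lintegral_mono fun a => ?_
  have h1 := weight_pos (t := t) a
  have h2 := weight_pos (t := t) v
  have h3 : normKernel n t x v * (k 0 a * reproKernel n t a (v - x)) - k 0 a * reproKernel n t a v =
      k 0 a * (normKernel n t x v * reproKernel n t a (v - x) - reproKernel n t a v) := by ring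
  have h4 := hN 0 a
  rw [zero_sub] at h4
  have h5 : weight t (0 : Cn n) = 1 := by simp [weight]
  calc ENNReal.ofReal (gaussDensity n t a) * ‖normKernel n t x v *
        (k 0 a * reproKernel n t a (v - x)) - k 0 a * reproKernel n t a v‖ₑ *
          ENNReal.ofReal (weight t v)
      = gaussConst n t * ENNReal.ofReal (‖k 0 a‖ * weight t (0 : Cn n) * weight t a) *
          reproDefect t x v a := by
        rw [h3, gaussDensity_eq ht, gaussConst, reproDefect, h5, ← ofReal_norm, norm_mul,
          ← ENNReal.ofReal_mul (by positivity), ← ENNReal.ofReal_mul (by positivity),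
          ← ENNReal.ofReal_mul (by positivity), ← ENNReal.ofReal_mul (by positivity)]
        congr 1; ring
    _ ≤ _ := by gcongr

/-- A majorant for the kernel of `α_x(A_k) - A_k`, depending only on a majorant `N` of `k`. -/
noncomputable def shiftMajorant (t : ℝ) (N : Cn n → ℝ≥0∞) (x u : Cn n) : ℝ≥0∞ :=
  (∫⁻ b, wnorm t (fun b => normKernel n t (-x) b - 1) b * (gaussConst n t * N (b - (-u - x)))) +
    ∫⁻ a, gaussConst n t * N (-a) * reproDefect t x (-u) a

/-- The kernel of `α_x(A_k) - A_k` is compared with `k` by moving one variable at a time. -/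
theorem IsWienerKernel.kernelBound_shift_sub (ht : 0 < t) {k : Cn n → Cn n → ℂ}
    (hk : IsWienerKernel n t k) {N : Cn n → ℝ≥0∞} (hN : KernelBound t k N) (x : Cn n) :
    KernelBound t (Fock.shiftKernel t x k - k) (shiftMajorant t N x) := fun w z => by
  -- by covariance it suffices to treat `w = 0`
  have hcent : ‖(Fock.shiftKernel t x k - k) w z‖ * weight t w * weight t z =
      ‖(Fock.shiftKernel t x (Fock.shiftKernel t (-w) k) - Fock.shiftKernel t (-w) k) 0 (z - w)‖ *
        weight t (0 : Cn n) * weight t (z - w) := by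
    rw [shiftKernel_shiftKernel ht, add_comm, ← shiftKernel_shiftKernel ht, ← shiftKernel_sub,
      norm_shiftKernel_mul_weight]
    simp
  rw [hcent]
  set l := Fock.shiftKernel t (-w) k with hl
  have hlW : IsWienerKernel n t l := hk.shiftKernel (-w)
  have hlN : KernelBound t l N := hN.shiftKernel (-w)
  have hwz : z - w = -(w - z) := (neg_sub w z).symm
  rw [hwz, shiftMajorant]
  set v := -(w - z) with hv
  have h0 : weight t (0 : Cn n) = 1 := by simp [weight]
  rw [h0, mul_one]
  refine le_trans ?_ (add_le_add (hlW.move_left_le ht hlN x (v - x)) (hlW.move_right_le ht hlN x v))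
  have hwv := weight_pos (t := t) v
  have hwx := weight_pos (t := t) (v - x)
  rw [← ENNReal.ofReal_add (by positivity) (by positivity)]
  refine ENNReal.ofReal_le_ofReal ?_
  rw [← norm_normKernel_mul_weight x v, ← mul_assoc, ← add_mul]
  gcongr
  rw [← norm_mul]
  refine le_trans (le_of_eq ?_) (norm_add_le _ _)
  congr 1
  simp only [Pi.sub_apply, Fock.shiftKernel, zero_sub]
  ring

theorem measurable_wnorm_normKernel_sub_one (x : Cn n) :
    Measurable (wnorm t fun b : Cn n => normKernel n t (-x) b - 1) :=
  measurable_wnorm (by fun_prop)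

theorem measurable_moveLeftIntegrand {N : Cn n → ℝ≥0∞} (hN : Measurable N) (x : Cn n) :
    Measurable fun p : Cn n × Cn n => wnorm t (fun b => normKernel n t (-x) b - 1) p.2 *
      (gaussConst n t * N (p.2 - (-p.1 - x))) := by
  have e1 : Measurable fun p : Cn n × Cn n =>
    wnorm t (fun b => normKernel n t (-x) b - 1) p.2 :=
    (measurable_wnorm_normKernel_sub_one x).comp measurable_snd
  have e2 : Measurable fun p : Cn n × Cn n => N (p.2 - (-p.1 - x)) := hN.comp (by fun_prop)
  exact e1.mul (e2.const_mul _)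

theorem measurable_moveRightIntegrand {N : Cn n → ℝ≥0∞} (hN : Measurable N) (x : Cn n) :
    Measurable fun p : Cn n × Cn n => gaussConst n t * N (-p.2) * reproDefect t x p.1 p.2 := by
  have e1 : Measurable fun p : Cn n × Cn n => N (-p.2) := hN.comp (by fun_prop)
  exact (e1.const_mul _).mul (measurable_reproDefect x)

theorem measurable_shiftMajorant {N : Cn n → ℝ≥0∞} (hN : Measurable N) (x : Cn n) :
    Measurable (shiftMajorant t N x) := by
  have h1 := measurable_moveLeftIntegrand (t := t) hN x
  have h2 := (measurable_moveRightIntegrand (t := t) hN x).comp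
    (by fun_prop : Measurable fun p : Cn n × Cn n => (-p.1, p.2))
  exact h1.lintegral_prod_right'.add h2.lintegral_prod_right'

theorem lintegral_shiftMajorant {N : Cn n → ℝ≥0∞} (hN : Measurable N) (x : Cn n) :
    ∫⁻ u, shiftMajorant t N x u =
      (∫⁻ b, wnorm t (fun b : Cn n => normKernel n t (-x) b - 1) b) *
          (gaussConst n t * ∫⁻ v, N v) +
        ∫⁻ p : Cn n × Cn n, gaussConst n t * N (-p.2) * reproDefect t x p.1 p.2 := by
  have hm := measurable_wnorm_normKernel_sub_one (t := t) x
  have h1 := measurable_moveLeftIntegrand (t := t) hN x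
  have h2 := measurable_moveRightIntegrand (t := t) hN x
  simp only [shiftMajorant]
  rw [lintegral_add_left h1.lintegral_prod_right']
  congr 1
  · rw [lintegral_lintegral_swap h1.aemeasurable, ← lintegral_mul_const _ hm]
    refine lintegral_congr fun b => ?_
    have e : ∀ u : Cn n, b - (-u - x) = u + (b + x) := fun u => by abel
    simp only [e]
    rw [lintegral_const_mul _ (by fun_prop), lintegral_const_mul _ (by fun_prop),
      lintegral_add_right_eq_self N]
  · rw [Measure.volume_eq_prod, lintegral_prod _ h2.aemeasurable]
    exact lintegral_neg_eq_self
      (fun v : Cn n => ∫⁻ a, gaussConst n t * N (-a) * reproDefect t x v a)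

/-- Dominated convergence: the translates involved are controlled by `envelope` for `|x| ≤ 1`. -/
theorem tendsto_lintegral_shiftMajorant (ht : 0 < t) {N : Cn n → ℝ≥0∞} (hN : Measurable N)
    (hNf : ∫⁻ v, N v < ∞) :
    Tendsto (fun x => ∫⁻ u, shiftMajorant t N x u) (𝓝 0) (𝓝 0) := by
  simp only [lintegral_shiftMajorant hN]
  have hnear : ∀ᶠ x in 𝓝 (0 : Cn n), ‖x‖ ≤ 1 := by
    filter_upwards [Metric.ball_mem_nhds (0 : Cn n) one_pos] with x hx
    exact (mem_ball_zero_iff.mp hx).le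
  have hc : gaussConst n t * ∫⁻ v, N v < ∞ := ENNReal.mul_lt_top ENNReal.ofReal_lt_top hNf
  have h1 : Tendsto (fun x : Cn n => ∫⁻ b, wnorm t (fun b => normKernel n t (-x) b - 1) b) (𝓝 0)
      (𝓝 (∫⁻ _ : Cn n, 0)) := by
    refine tendsto_lintegral_filter_of_dominated_convergence
      (fun b => ENNReal.ofReal (2 * envelope t b))
      (Eventually.of_forall measurable_wnorm_normKernel_sub_one)
      (hnear.mono fun x hx => Eventually.of_forall fun b => wnorm_normKernel_sub_one_le ht hx b)
      (lintegral_envelope_lt_top ht).ne (Eventually.of_forall fun b => ?_)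
    have hcont : Continuous fun x : Cn n => ‖normKernel n t (-x) b - 1‖ * weight t b := by
      fun_prop
    have h := ENNReal.tendsto_ofReal (hcont.tendsto 0)
    simpa [normKernel, wnorm, ENNReal.ofReal_mul] using h
  have h2 : Tendsto (fun x : Cn n => ∫⁻ p : Cn n × Cn n,
      gaussConst n t * N (-p.2) * reproDefect t x p.1 p.2) (𝓝 0) (𝓝 (∫⁻ _ : Cn n × Cn n, 0)) := by
    have hNm : Measurable fun p : Cn n × Cn n => gaussConst n t * N (-p.2) := by
      have e1 : Measurable fun p : Cn n × Cn n => N (-p.2) := hN.comp (by fun_prop)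
      exact e1.const_mul _
    have hEm : Measurable fun p : Cn n × Cn n => ENNReal.ofReal (2 * envelope t (p.1 - p.2)) :=
      measurable_envelope.comp (by fun_prop : Measurable fun p : Cn n × Cn n => p.1 - p.2)
    have hNE : Measurable fun p : Cn n × Cn n => gaussConst n t * N (-p.2) *
        ENNReal.ofReal (2 * envelope t (p.1 - p.2)) := hNm.mul hEm
    have hNneg : Measurable fun a : Cn n => gaussConst n t * N (-a) := by fun_prop
    have hNint : ∫⁻ a : Cn n, gaussConst n t * N (-a) < ∞ := by
      rw [lintegral_const_mul _ (by fun_prop), lintegral_neg_eq_self N]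
      exact hc
    refine tendsto_lintegral_filter_of_dominated_convergence
      (fun p : Cn n × Cn n => gaussConst n t * N (-p.2) *
        ENNReal.ofReal (2 * envelope t (p.1 - p.2)))
      (Eventually.of_forall fun x => hNm.mul (measurable_reproDefect x))
      (hnear.mono fun x hx => Eventually.of_forall fun p => ?_) ?_ ?_
    · gcongr
      exact reproDefect_le ht hx _ _
    · rw [Measure.volume_eq_prod, lintegral_prod_symm _ hNE.aemeasurable]
      have e : ∀ a : Cn n, ∫⁻ v : Cn n, gaussConst n t * N (-a) *
          ENNReal.ofReal (2 * envelope t (v - a)) =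
            gaussConst n t * N (-a) * ∫⁻ v : Cn n, ENNReal.ofReal (2 * envelope t v) := fun a => by
        have hm : Measurable fun v : Cn n => ENNReal.ofReal (2 * envelope t (v - a)) :=
          measurable_envelope.comp (measurable_sub_const a)
        rw [lintegral_const_mul _ hm,
          lintegral_sub_right_eq_self (fun v : Cn n => ENNReal.ofReal (2 * envelope t v)) a]
      simp only [e]
      rw [lintegral_mul_const _ hNneg]
      exact (ENNReal.mul_lt_top hNint (lintegral_envelope_lt_top ht)).ne
    · have hfin : ∀ᵐ p : Cn n × Cn n, gaussConst n t * N (-p.2) < ∞ := by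
        rw [Measure.volume_eq_prod]
        exact Measure.quasiMeasurePreserving_snd.ae (ae_lt_top hNneg hNint.ne)
      filter_upwards [hfin] with p hp
      have hcont : Continuous fun x : Cn n => weight t p.2 * weight t p.1 *
          ‖normKernel n t x p.1 * reproKernel n t p.2 (p.1 - x) - reproKernel n t p.2 p.1‖ := by
        fun_prop
      have h := ENNReal.Tendsto.const_mul (a := gaussConst n t * N (-p.2))
        (ENNReal.tendsto_ofReal (hcont.tendsto 0)) (Or.inr hp.ne)
      simpa [normKernel, reproDefect] using h
  rw [lintegral_zero] at h1 h2
  have h3 := (ENNReal.Tendsto.mul_const (b := gaussConst n t * ∫⁻ v, N v) h1 (Or.inr hc.ne)).add h2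
  simpa using h3

theorem wienerOperators_subset_C1 [Fact (0 < t)] : wienerOperators n t i ⊆ C1 n t i := by
  rintro A ⟨k, hk, hA⟩
  have ht : 0 < t := Fact.out
  obtain ⟨N, hNm, hNf, hN⟩ := hk.exists_kernelBound
  have hle : ∀ x : Cn n, ENNReal.ofReal ‖shift x A - A‖ ≤
      gaussConst n t * ∫⁻ u, shiftMajorant t N x u := fun x =>
    ((hA.shift x).sub hA).norm_le (measurable_shiftMajorant hNm x)
      (hk.kernelBound_shift_sub ht hN x)
  have hlim := ENNReal.Tendsto.const_mul (a := gaussConst n t)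
    (tendsto_lintegral_shiftMajorant ht hNm hNf) (Or.inr ENNReal.ofReal_ne_top)
  rw [mul_zero] at hlim
  have h := tendsto_of_tendsto_of_tendsto_of_le_of_le tendsto_const_nhds hlim (fun _ => zero_le) hle
  have h2 := (ENNReal.tendsto_toReal ENNReal.zero_ne_top).comp h
  refine h2.congr fun x => ?_
  rw [Function.comp_apply, ENNReal.toReal_ofReal (norm_nonneg _)]

/-! ### Gaussian averages determine a bounded continuous function -/

/-- A continuous function all of whose Gaussian averages vanish is zero. The integrals
`∫ φ(y) e^{-|y|²/t} e^{s⟨x, y⟩} dy` vanish for real `s`, hence for all complex `s`, so that the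
Fourier transform of `φ e^{-|·|²/t}` is zero. -/
theorem eq_zero_of_integral_gaussMeasure_eq_zero (ht : 0 < t) {φ : Cn n → ℂ} (hφ : Continuous φ)
    {C : ℝ} (hC : ∀ y, ‖φ y‖ ≤ C) (h : ∀ x, ∫ y, φ (x + y) ∂gaussMeasure n t = 0) : φ = 0 := by
  set g : Cn n → ℂ := fun y => φ y * gaussDensity n t y with hg
  have hgc : Continuous g := hφ.mul (Complex.continuous_ofReal.comp (continuous_gaussDensity n t))
  have hgi : ∀ R : ℝ, Integrable fun y => ‖g y‖ * Real.exp (R * ‖y‖) := fun R => by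
    refine ((integrable_exp_neg_mul_sq_add (n := n) (inv_pos.mpr ht) R).const_mul
      (C * ((Real.pi * t) ^ n)⁻¹)).mono' (by fun_prop) (Eventually.of_forall fun y => ?_)
    rw [Real.norm_of_nonneg (by positivity), hg, norm_mul, Complex.norm_real,
      Real.norm_of_nonneg (gaussDensity_pos n ht y).le, gaussDensity, Real.exp_add]
    have e : -t⁻¹ * ‖y‖ ^ 2 = -(‖y‖ ^ 2 / t) := by ring
    have hy := hC y
    rw [e]
    calc _ = ‖φ y‖ * (((Real.pi * t) ^ n)⁻¹ *
          (Real.exp (-(‖y‖ ^ 2 / t)) * Real.exp (R * ‖y‖))) := by ring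
      _ ≤ C * (((Real.pi * t) ^ n)⁻¹ *
          (Real.exp (-(‖y‖ ^ 2 / t)) * Real.exp (R * ‖y‖))) := by gcongr
      _ = _ := by ring
  have hreal : ∀ x : Cn n, ∫ y, g y * Complex.exp ((2 / t * inner ℝ x y : ℝ) : ℂ) = 0 := fun x => by
    have h1 := h x
    rw [integral_gaussMeasure ht, ← integral_sub_right_eq_self _ x] at h1
    have h2 : ∀ y, (gaussDensity n t (y - x) : ℂ) * φ (x + (y - x)) =
        (Real.exp (-(‖x‖ ^ 2 / t)) : ℂ) * (g y * Complex.exp ((2 / t * inner ℝ x y : ℝ) : ℂ)) := by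
      intro y
      have h3 : gaussDensity n t (y - x) =
          Real.exp (-(‖x‖ ^ 2 / t)) * gaussDensity n t y * Real.exp (2 / t * inner ℝ x y) := by
        rw [gaussDensity, gaussDensity, norm_sub_sq_real, real_inner_comm]
        calc _ = ((Real.pi * t) ^ n)⁻¹ * (Real.exp (-(‖x‖ ^ 2 / t)) * Real.exp (-(‖y‖ ^ 2 / t)) *
              Real.exp (2 / t * inner ℝ x y)) := by
              rw [← Real.exp_add, ← Real.exp_add]
              congr 2; ring
          _ = _ := by ring
      rw [h3, hg, ← Complex.ofReal_exp]
      push_cast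
      rw [add_sub_cancel]
      ring
    simp only [h2] at h1
    rw [integral_const_mul] at h1
    exact (mul_eq_zero.mp h1).resolve_left (by exact_mod_cast (Real.exp_pos _).ne')
  have hcomplex : ∀ (x : Cn n) (s : ℂ),
      ∫ y, g y * Complex.exp ((inner ℝ x y : ℝ) * s) = 0 := fun x s => by
    have hl : Continuous fun y : Cn n =>
        ((inner ℝ x y : ℝ) : ℂ) • ContinuousLinearMap.id ℂ ℂ := by fun_prop
    have hd := differentiable_integral_mul_cexp hgc.aestronglyMeasurable hgi hl (C := ‖x‖)
      (fun y => by
        rw [norm_smul, Complex.norm_real, ContinuousLinearMap.norm_id, mul_one]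
        exact norm_inner_le_norm x y)
    have ha := (hd.differentiableOn (s := Set.univ)).analyticOnNhd isOpen_univ
    have hfreq : ∃ᶠ s in 𝓝[≠] (0 : ℂ), (∫ y, g y * Complex.exp
        ((((inner ℝ x y : ℝ) : ℂ) • ContinuousLinearMap.id ℂ ℂ) s)) = 0 := by
      have htend : Tendsto (fun r : ℝ => (r : ℂ)) (𝓝[≠] 0) (𝓝[≠] 0) := by
        refine tendsto_nhdsWithin_iff.mpr ⟨?_, ?_⟩
        · exact (Complex.continuous_ofReal.tendsto' 0 0 (by simp)).mono_left nhdsWithin_le_nhds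
        · filter_upwards [self_mem_nhdsWithin] with r hr
          simpa using hr
      refine htend.frequently (Eventually.frequently (Eventually.of_forall fun r => ?_))
      rw [← hreal ((t / 2 * r) • x)]
      refine integral_congr_ae (Eventually.of_forall fun y => ?_)
      simp only [FunLike.coe_smul, Pi.smul_apply, ContinuousLinearMap.id_apply, smul_eq_mul,
        real_inner_smul_left]
      rw [← Complex.ofReal_mul]
      congr 3
      field_simp
    have h0 := ha.eq_of_frequently_eq (g := fun _ => 0) analyticOnNhd_const hfreq
    have := congrFun h0 s
    simpa using this
  have hF : FourierTransform.fourier g = 0 := by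
    funext x
    rw [Real.fourier_eq', Pi.zero_apply, ← hcomplex x (-2 * Real.pi * Complex.I)]
    refine integral_congr_ae (Eventually.of_forall fun y => ?_)
    simp only [smul_eq_mul]
    rw [mul_comm, real_inner_comm]
    congr 2
    push_cast
    ring
  have hgint : Integrable g := by
    have := hgi 0
    simp only [zero_mul, Real.exp_zero, mul_one] at this
    exact (integrable_norm_iff hgc.aestronglyMeasurable).mp this
  have hinv : ∀ y, g y = 0 := fun y => by
    have h1 := hgint.fourierInv_fourier_eq (by rw [hF]; exact integrable_zero _ _ _)
      (hgc.continuousAt (x := y))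
    rw [← h1, hF, Real.fourierInv_eq']
    simp
  funext y
  have h1 := hinv y
  rw [hg] at h1
  exact (mul_eq_zero.mp h1).resolve_right (by exact_mod_cast (gaussDensity_pos n ht y).ne')

/-! ### Gaussian averages of orbits are Toeplitz operators -/

/-- Gaussian double integrals localize at `u = w / 2`: after exchanging the order of
integration, the inner integral is an instance of the reproducing formula with parameter `t / 2`. -/
theorem IsWienerKernel.integral_integral_eq (ht : 0 < t) {k : Cn n → Cn n → ℂ}
    (hk : IsWienerKernel n t k) {F : Cn n → Cn n → ℂ} (hFm : Measurable (Function.uncurry F))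
    (hF : ∀ w, Differentiable ℂ (F w)) {C : ℝ}
    (hC : ∀ w u, ‖F w u‖ * (weight t u * weight t (w - u)) ≤ C) :
    ∫ u, ∫ w, (weight t u : ℂ) ^ 2 * (F w u * k w u * reproKernel n t u w)
        ∂gaussMeasure n t ∂gaussMeasure n t =
      ∫ w, ((2 : ℂ) ^ n)⁻¹ * (F w ((2 : ℂ)⁻¹ • w) * k w ((2 : ℂ)⁻¹ • w)) ∂gaussMeasure n t := by
  obtain ⟨H, h0, hHi, hb⟩ := hk.exists_real_bound
  have hC0 : 0 ≤ C := le_trans (mul_nonneg (norm_nonneg _)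
    (mul_pos (weight_pos _) (weight_pos _)).le) (hC 0 0)
  set P : Cn n → Cn n → ℂ := fun u w => (gaussDensity n t u : ℂ) * ((gaussDensity n t w : ℂ) *
    ((weight t u : ℂ) ^ 2 * (F w u * k w u * reproKernel n t u w))) with hP
  have hPm : Measurable (Function.uncurry P) := by
    have e1 : Measurable fun p : Cn n × Cn n => F p.2 p.1 := hFm.comp measurable_swap
    have e2 : Measurable fun p : Cn n × Cn n => k p.2 p.1 := hk.measurable.comp measurable_swap
    have e3 : Continuous fun p : Cn n × Cn n => reproKernel n t p.1 p.2 := by fun_prop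
    have e4 : Continuous fun p : Cn n × Cn n => (gaussDensity n t p.1 : ℂ) :=
      Complex.continuous_ofReal.comp ((continuous_gaussDensity n t).comp continuous_fst)
    have e5 : Continuous fun p : Cn n × Cn n => (gaussDensity n t p.2 : ℂ) :=
      Complex.continuous_ofReal.comp ((continuous_gaussDensity n t).comp continuous_snd)
    have e6 : Continuous fun p : Cn n × Cn n => (weight t p.1 : ℂ) ^ 2 :=
      (Complex.continuous_ofReal.comp (continuous_weight.comp continuous_fst)).pow 2
    exact e4.measurable.mul (e5.measurable.mul (e6.measurable.mul ((e1.mul e2).mul e3.measurable)))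
  -- the Gaussian densities supply all the weights for `F`, `k` and the kernel, and one more for `u`
  have hPb : ∀ u w, ‖P u w‖ ≤
      (((Real.pi * t) ^ n)⁻¹ * ((Real.pi * t) ^ n)⁻¹ * C) * (weight t u * H (w - u)) := by
    intro u w
    have hu := weight_pos (t := t) u
    have hw := weight_pos (t := t) w
    have hwu := weight_pos (t := t) (w - u)
    have hK : ‖reproKernel n t u w‖ * weight t u * weight t w = weight t (w - u) := by
      rw [norm_reproKernel_mul_weight, mul_right_comm, inv_mul_cancel₀ hw.ne', one_mul, weight,
        weight, norm_sub_rev]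
    have hgn : ∀ v : Cn n, ‖(gaussDensity n t v : ℂ)‖ =
        ((Real.pi * t) ^ n)⁻¹ * (weight t v * weight t v) := fun v => by
      rw [Complex.norm_real, Real.norm_of_nonneg (gaussDensity_pos n ht v).le, gaussDensity_eq ht]
    have h1 : ‖P u w‖ = ((Real.pi * t) ^ n)⁻¹ * ((Real.pi * t) ^ n)⁻¹ *
        (‖F w u‖ * (weight t u * weight t (w - u))) *
          (weight t u * (‖k w u‖ * weight t w * weight t u)) := by
      rw [← hK]
      simp only [hP, norm_mul, norm_pow, hgn]
      rw [Complex.norm_real, Real.norm_of_nonneg hu.le]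
      ring
    rw [h1]
    have h2 := hC w u
    have h3 := hb w u
    have h4 := h0 (w - u)
    gcongr
  have hPi : Integrable (Function.uncurry P) (volume.prod volume) := by
    have h1 := Integrable.convolution_integrand (ContinuousLinearMap.mul ℝ ℝ)
      (integrable_weight (n := n) ht) hHi
    have h2 := h1.swap
    refine (h2.const_mul (((Real.pi * t) ^ n)⁻¹ * ((Real.pi * t) ^ n)⁻¹ * C)).mono'
      hPm.aestronglyMeasurable (Eventually.of_forall fun p => ?_)
    exact hPb p.1 p.2
  have hLHS : ∫ u, ∫ w, (weight t u : ℂ) ^ 2 * (F w u * k w u * reproKernel n t u w)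
      ∂gaussMeasure n t ∂gaussMeasure n t = ∫ u, ∫ w, P u w := by
    rw [integral_gaussMeasure ht]
    refine integral_congr_ae (Eventually.of_forall fun u => ?_)
    simp only [hP]
    rw [integral_gaussMeasure ht, integral_const_mul]
  rw [hLHS, integral_integral_swap hPi, integral_gaussMeasure ht]
  have ht2 : 0 < t / 2 := half_pos ht
  have hne : (t : ℂ) ≠ 0 := by exact_mod_cast ht.ne'
  have hgw : ∀ u : Cn n, (gaussDensity n t u : ℂ) * (weight t u : ℂ) ^ 2 =
      ((2 : ℂ) ^ n)⁻¹ * gaussDensity n (t / 2) u := fun u => by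
    have h1 : gaussDensity n t u * weight t u ^ 2 = ((2 : ℝ) ^ n)⁻¹ * gaussDensity n (t / 2) u := by
      have h2 : weight (t / 2) u = weight t u * weight t u := by
        simp only [weight, ← Real.exp_add]
        congr 1; field_simp; ring
      have h3 : Real.pi * t = 2 * (Real.pi * (t / 2)) := by ring
      rw [gaussDensity_eq ht, gaussDensity_eq ht2, h2, h3, mul_pow 2, mul_inv]
      ring
    have h4 := congrArg Complex.ofReal h1
    push_cast at h4
    exact h4
  have hKw : ∀ u w : Cn n, reproKernel n t u w = reproKernel n (t / 2) u ((2 : ℂ)⁻¹ • w) := by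
    intro u w
    rw [reproKernel, reproKernel, inner_smul_right]
    congr 1
    push_cast
    field_simp
  have hPw : ∀ u w : Cn n, P u w = ((gaussDensity n t w : ℂ) * ((2 : ℂ) ^ n)⁻¹) *
      ((gaussDensity n (t / 2) u : ℂ) *
        ((F w u * k w u) * reproKernel n (t / 2) u ((2 : ℂ)⁻¹ • w))) := fun u w => by
    simp only [hP]
    rw [← hKw]
    linear_combination ((gaussDensity n t w : ℂ) * (F w u * k w u * reproKernel n t u w)) * hgw u
  refine integral_congr_ae ?_
  filter_upwards [hPi.prod_left_ae] with w hw
  have hgne : (gaussDensity n t w : ℂ) * ((2 : ℂ) ^ n)⁻¹ ≠ 0 :=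
    mul_ne_zero (by exact_mod_cast (gaussDensity_pos n ht w).ne')
      (inv_ne_zero (pow_ne_zero _ two_ne_zero))
  simp only [Function.uncurry, hPw] at hw
  rw [integrable_const_mul_iff (IsUnit.mk0 _ hgne)] at hw
  have hrep := Fock.integral_mul_reproKernel ht2 ((hF w).mul (hk.holomorphic w))
    ((integrable_gaussMeasure_iff ht2).mpr hw)
  rw [integral_gaussMeasure ht2] at hrep
  simp only [hPw]
  rw [integral_const_mul, ← mul_assoc]
  congr 1

section
variable [Fact (0 < t)]

/-- The Berezin transform of `A_k`, that is, the function `k(u, u) e^{-|u|²/t}`. -/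
noncomputable def berezin (t : ℝ) (k : Cn n → Cn n → ℂ) (u : Cn n) : ℂ :=
  k u u * (weight t u : ℂ) ^ 2

/-- The Gaussian average of the orbit of `A_k`, evaluated at the origin. -/
theorem integral_shift_apply_zero {k : Cn n → Cn n → ℂ} (hk : IsWienerKernel n t k)
    {A : FockSpace n t i →L[ℂ] FockSpace n t i} (hA : IsIntegralOperator k A)
    (f : FockSpace n t i) :
    ∫ x, shift x A f 0 ∂gaussMeasure n t = ∫ u, berezin t k u * f u ∂gaussMeasure n t := by
  have ht : 0 < t := Fact.out
  have hf : Differentiable ℂ f.1 := f.2.1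
  have hfm : Measurable f.1 := hf.continuous.measurable
  -- both sides are double integrals that only depend on the value of an integrand at `u = w / 2`
  have h1 := hk.integral_integral_eq ht (F := fun w u => f (w - u))
    (hfm.comp (measurable_fst.sub measurable_snd))
    (fun w => hf.comp (differentiable_id.const_sub w)) (C := ‖f‖) fun w u => by
      have hw := f.norm_mul_weight_le (w - u)
      have hu := weight_le_one ht u
      have h0 := weight_pos (t := t) u
      calc _ = (‖f (w - u)‖ * weight t (w - u)) * weight t u := by ring
        _ ≤ ‖f‖ * 1 := by gcongr
        _ = ‖f‖ := mul_one _
  have h2 := hk.integral_integral_eq ht (F := fun _ u => f u)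
    (hfm.comp measurable_snd) (fun _ => hf) (C := ‖f‖) fun w u => by
      have hw := f.norm_mul_weight_le u
      have hu := weight_le_one ht (w - u)
      have h0 := weight_pos (t := t) (w - u)
      calc _ = (‖f u‖ * weight t u) * weight t (w - u) := by ring
        _ ≤ ‖f‖ * 1 := by gcongr
        _ = ‖f‖ := mul_one _
  have hhalf : ∀ w : Cn n, w - (2 : ℂ)⁻¹ • w = (2 : ℂ)⁻¹ • w := fun w => by
    rw [sub_eq_iff_eq_add, ← add_smul]; norm_num
  simp only [hhalf] at h1
  have hneg : ∫ x, shift x A f 0 ∂gaussMeasure n t =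
      ∫ x, shift (-x) A f 0 ∂gaussMeasure n t := by
    rw [integral_gaussMeasure ht, integral_gaussMeasure ht, ← integral_neg_eq_self]
    simp only [gaussDensity, norm_neg]
  rw [hneg]
  refine Eq.trans ?_ (h1.trans (h2.symm.trans ?_))
  · refine integral_congr_ae (Eventually.of_forall fun u => ?_)
    simp only
    rw [shift_apply, (hA _ _).2, ← integral_const_mul]
    refine integral_congr_ae (Eventually.of_forall fun w => ?_)
    simp only
    rw [weyl_apply, neg_neg, zero_sub, neg_neg]
    have e : normKernel n t (-u) 0 * normKernel n t u w =
        (weight t u : ℂ) ^ 2 * reproKernel n t u w := by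
      simp only [normKernel, reproKernel, weight, Complex.ofReal_exp, ← Complex.exp_add,
        ← Complex.exp_nat_mul]
      congr 1
      rw [inner_zero_right, norm_neg]
      push_cast
      ring
    linear_combination (f (w - u) * k w u) * e
  · refine integral_congr_ae (Eventually.of_forall fun u => ?_)
    simp only [berezin]
    have e := (hk.integral_mul_reproKernel_left ht u u).2
    rw [← e, ← integral_mul_const, ← integral_mul_const]
    refine integral_congr_ae (Eventually.of_forall fun w => ?_)
    simp only
    ring

/-- Covariance, which reduces evaluation of `α_y(A) f` at `x` to evaluation at the origin. -/
theorem shift_neg_weyl (x y : Cn n) (A : FockSpace n t i →L[ℂ] FockSpace n t i)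
    (f : FockSpace n t i) :
    shift y (shift (-x) A) (weyl n t i (-x) f) 0 = weight t x * shift y A f x := by
  have h1 : shift y (shift (-x) A) = shift (-x) (shift y A) := by
    rw [shift_shift, shift_shift, add_comm]
  have h2 : weyl n t i x (weyl n t i (-x) f) = f := by
    rw [weyl_weyl, add_neg_cancel]
    refine FockSpace.ext fun z => ?_
    change weylPhase t x (-x) * (normKernel n t 0 z * f (z - 0)) = f z
    simp [weylPhase, normKernel]
  rw [h1, shift_apply (-x), neg_neg, h2, zero_sub, neg_neg]
  congr 1
  simp [normKernel, weight]

/-- The average at an arbitrary point, obtained from the origin by covariance. -/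
theorem integral_shift_apply {k : Cn n → Cn n → ℂ} (hk : IsWienerKernel n t k)
    {A : FockSpace n t i →L[ℂ] FockSpace n t i} (hA : IsIntegralOperator k A)
    (f : FockSpace n t i) (z : Cn n) :
    ∫ x, shift x A f z ∂gaussMeasure n t =
      fockProjection n t (fun u => berezin t k u * f u) z := by
  have ht : 0 < t := Fact.out
  have h := integral_shift_apply_zero (hk.shiftKernel (-z)) (hA.shift (-z)) (weyl n t i (-z) f)
  simp only [shift_neg_weyl] at h
  rw [integral_const_mul] at h
  have hz : (weight t z : ℂ) ≠ 0 := by exact_mod_cast (weight_pos z).ne'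
  refine mul_left_cancel₀ hz (h.trans ?_)
  rw [fockProjection, integral_gaussMeasure ht, integral_gaussMeasure ht, ← integral_const_mul,
    ← integral_sub_right_eq_self _ z]
  refine integral_congr_ae (Eventually.of_forall fun u => ?_)
  have h1 := gaussDensity_mul_normKernel ht z u
  have h2 : (starRingEnd ℂ) (normKernel n t z u) = weight t z * reproKernel n t u z := by
    simp only [normKernel, reproKernel, weight, Complex.ofReal_exp, ← Complex.exp_conj,
      ← Complex.exp_add]
    rw [map_sub, map_div₀, Complex.conj_ofReal, Complex.conj_ofReal, inner_conj_symm]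
    congr 1
    push_cast
    ring
  have h3 : berezin t (shiftKernel t (-z) k) (u - z) = berezin t k u := by
    have h4 := norm_normKernel_mul_weight (t := t) (-z) (u - z)
    rw [sub_neg_eq_add, sub_add_cancel] at h4
    rw [berezin, berezin, shiftKernel, Complex.mul_conj', sub_neg_eq_add, sub_add_cancel, ← h4]
    push_cast
    ring
  simp only [h3]
  rw [weyl_apply, sub_neg_eq_add, sub_add_cancel]
  linear_combination (berezin t k u * f u) * h1 + (gaussDensity n t u * berezin t k u * f u) * h2

/-- The Gaussian average of the orbit of `A_k` is the Toeplitz operator whose symbol is the Berezin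
transform of `A_k`. -/
theorem isToeplitz_integral_shift {k : Cn n → Cn n → ℂ} (hk : IsWienerKernel n t k)
    {A : FockSpace n t i →L[ℂ] FockSpace n t i} (hA : IsIntegralOperator k A) :
    MemLp (berezin t k) ∞ volume ∧
      IsToeplitz (berezin t k) (∫ x, shift x A ∂gaussMeasure n t) := by
  have ht : 0 < t := Fact.out
  have := isProbabilityMeasure_gaussMeasure n ht
  obtain ⟨H, -, -, hb⟩ := hk.exists_real_bound
  have hbm : Measurable (berezin t k) := by
    have h1 : Measurable fun u => k u u := hk.measurable.comp (measurable_id.prodMk measurable_id)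
    exact h1.mul ((Complex.continuous_ofReal.comp continuous_weight).pow 2).measurable
  have hbb : ∀ u, ‖berezin t k u‖ ≤ H 0 := fun u => by
    have h1 := hb u u
    rw [sub_self] at h1
    rw [berezin, norm_mul, norm_pow, Complex.norm_real, Real.norm_of_nonneg (weight_pos u).le]
    linarith
  refine ⟨memLp_top_of_bound hbm.aestronglyMeasurable (H 0) (Eventually.of_forall hbb),
    fun f z => ⟨?_, ?_⟩⟩
  · refine integrable_mul_reproKernel_of_bounded ht
      (hbm.mul f.continuous.measurable).aestronglyMeasurable (C := H 0 * ‖f‖) (fun u => ?_) z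
    have := weight_pos (t := t) u
    change ‖berezin t k u * f u‖ * weight t u ≤ _
    rw [norm_mul, mul_assoc]
    exact mul_le_mul (hbb u) (f.norm_mul_weight_le u) (by positivity)
      ((norm_nonneg _).trans (hbb u))
  · have hcont := continuous_shift (wienerOperators_subset_C1 ⟨k, hk, hA⟩)
    have hint : Integrable (fun x : Cn n => shift x A) (gaussMeasure n t) :=
      Integrable.of_bound hcont.aestronglyMeasurable ‖A‖
        (Eventually.of_forall fun x => norm_shift_le x A)
    have h := ((evalCLM n t i z).comp
      (ContinuousLinearMap.apply ℂ (FockSpace n t i) f)).integral_comp_comm hint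
    rw [← integral_shift_apply hk hA f z]
    exact h.symm

/-! ### Approximation by Toeplitz operators -/

theorem IsToeplitz.mem_toeplitzAlgebra {g : Cn n → ℂ}
    {T : FockSpace n t i →L[ℂ] FockSpace n t i} (hg : MemLp g ∞ volume) (hT : IsToeplitz g T) :
    T ∈ toeplitzAlgebra n t i :=
  Subalgebra.le_topologicalClosure _ (Algebra.subset_adjoin ⟨g, hg, hT⟩)

/-- A functional that annihilates the Toeplitz operators annihilates all Gaussian averages of the
orbit of `A_k`, hence, by `eq_zero_of_integral_gaussMeasure_eq_zero`, the orbit itself. -/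
theorem wienerOperators_subset_toeplitzAlgebra :
    wienerOperators n t i ⊆ toeplitzAlgebra n t i := by
  rintro A ⟨k, hk, hA⟩
  have ht : 0 < t := Fact.out
  have := isProbabilityMeasure_gaussMeasure n ht
  by_contra hnot
  obtain ⟨l, c, hlt, hgt⟩ := RCLike.geometric_hahn_banach_closed_point (𝕜 := ℂ)
    (s := (toeplitzAlgebra n t i : Set (FockSpace n t i →L[ℂ] FockSpace n t i)))
    ((toeplitzAlgebra n t i).toSubmodule.restrictScalars ℝ).convex
    (Subalgebra.isClosed_topologicalClosure _) hnot
  -- a functional bounded above on a subspace vanishes there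
  have hzero : ∀ T ∈ toeplitzAlgebra n t i, l T = 0 := fun T hT => by
    by_contra hne
    have h1 := hlt (((|c| + 1 : ℝ) / l T : ℂ) • T) (Subalgebra.smul_mem _ hT _)
    rw [map_smul, smul_eq_mul, div_mul_cancel₀ _ hne] at h1
    simp only [RCLike.re_to_complex, Complex.ofReal_re] at h1
    linarith [le_abs_self c]
  have hcont := continuous_shift (wienerOperators_subset_C1 ⟨k, hk, hA⟩)
  have hφ : (fun x : Cn n => l (shift x A)) = 0 := by
    refine eq_zero_of_integral_gaussMeasure_eq_zero ht (l.continuous.comp hcont)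
      (C := ‖l‖ * ‖A‖) (fun x => (l.le_opNorm _).trans (by gcongr; exact norm_shift_le x A))
      fun x => ?_
    have hcx := continuous_shift (wienerOperators_subset_C1 ⟨_, hk.shiftKernel x, hA.shift x⟩)
    have hint : Integrable (fun y : Cn n => shift y (shift x A)) (gaussMeasure n t) :=
      Integrable.of_bound hcx.aestronglyMeasurable ‖shift x A‖
        (Eventually.of_forall fun y => norm_shift_le y _)
    obtain ⟨hg, hT⟩ := isToeplitz_integral_shift (hk.shiftKernel x) (hA.shift x)
    rw [← hzero _ (hT.mem_toeplitzAlgebra hg), ← l.integral_comp_comm hint]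
    simp only [shift_shift, add_comm]
  have h0 : l A = 0 := by simpa [shift_zero] using congrFun hφ 0
  have h1 := hlt 0 (zero_mem _)
  rw [h0] at hgt
  rw [map_zero] at h1
  exact lt_asymm h1 hgt

end
end Fock

theorem mainTheorem6 (n : ℕ) (t : ℝ) [Fact (0 < t)] (i : Fock.FockIndex) :
    (∀ k : Fock.Cn n → Fock.Cn n → ℂ, Fock.IsWienerKernel n t k →
      ∃ A : Fock.FockSpace n t i →L[ℂ] Fock.FockSpace n t i, Fock.IsIntegralOperator k A) ∧
    Fock.wienerOperators n t i ⊆ Fock.C1 n t i ∧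
    Fock.wienerOperators n t i ⊆ Fock.toeplitzAlgebra n t i :=
  ⟨fun _ hk => hk.exists_isIntegralOperator i, Fock.wienerOperators_subset_C1,
    Fock.wienerOperators_subset_toeplitzAlgebra⟩
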